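/- Let $M$ be an oriented smooth $m$-manifold ($m\ge 1$), $\mathcal E\to M$ a smooth vector bundle of rank $m$ with a smooth fibre metric $\langle\ ,\ \rangle$, $D$ a smooth metric connection on $\mathcal E$, and $\varphi,\psi\colon TM\to\mathcal E$ smooth bundle homomorphisms such that for $\theta\in\{\varphi,\psi\}$ and all vector fields $X,Y$ one has $D_X\theta(Y)-D_Y\theta(X)-\theta([X,Y])=0$, such that $\langle\varphi(X),\psi(Y)\rangle=\langle\varphi(Y),\psi(X)\rangle$, and such that $\ker\varphi_x\cap\ker\psi_x=\{0\}$ for every $x\in M$; that is, $(M,\mathcal E,\langle\ ,\ \rangle,D,\varphi,\psi)$ is a front bundle. Let $\mathcal E$ be co-oriented by a smooth section $\mu$ of $\det\mathcal E^*$ with values $\pm1$ on orthonormal frames. Let $\Sigma=\{x\in M:\varphi_x\text{ is not bijective}\}$, and in a positively oriented coordinate system $(u_1,\dots,u_m)$ put $\lambda=\mu(\varphi(\partial_1),\dots,\varphi(\partial_m))$, so that $\Sigma=\{\lambda=0\}$ there. A point $p\in\Sigma$ is an $A_2$-point if $d\lambda_p\ne 0$ and $\ker\varphi_p$ is transversal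 to $T_p\Sigma=\ker d\lambda_p$. Put $I(X,Y)=\langle\varphi(X),\varphi(Y)\rangle$, $I\!I(X,Y)=-\langle\varphi(X),\psi(Y)\rangle$ and, for $q\in M\setminus\Sigma$ and linearly independent $X,Y\in T_qM$, $$K^{\mathrm{ext}}(X\wedge Y)=\frac{I\!I(X,X)\,I\!I(Y,Y)-I\!I(X,Y)^2}{I(X,X)\,I(Y,Y)-I(X,Y)^2}.$$ At an $A_2$-point $p$ choose, near $p$, a smooth $I$-orthonormal frame $e_1,\dots,e_{m-1}$ which is tangent to $\Sigma$ along $\Sigma$, the smooth section $n$ of $\mathcal E$ for which $(\varphi(e_1),\dots,\varphi(e_{m-1}),n)$ is orthonormal with $\mu(\varphi(e_1),\dots,\varphi(e_{m-1}),n)=1$, and $\eta\in\ker\varphi_p$ for which $(e_1,\dots,e_{m-1},\eta)$ is a positively oriented basis of $T_pM$. The singular principal curvatures at $p$ are the eigenvalues of the singular shape operator $S(X)=-\operatorname{sgn}(d\lambda_p(\eta))\,\varphi^{-1}(D_Xn)$ on $T_p\Sigma$, where $\varphi^{-1}$ is the inverse of $\varphi_p|_{T_p\Sigma}$. Let $p\in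 M$ be an $A_2$-point of $\varphi$. Then the following hold. (1) If $K^{\mathrm{ext}}$ is bounded on $U\setminus\Sigma$ (over all points and all tangent planes) for some neighborhood $U$ of $p$, then $I\!I(X,Y)=0$ for all $X,Y\in T_pM$. (2) If $U$ is a neighborhood of $p$ such that $K^{\mathrm{ext}}$ does not change sign on $U\setminus\Sigma$ (it is everywhere $\ge0$ or everywhere $\le0$), then $K^{\mathrm{ext}}$ is bounded on $W\setminus\Sigma$ for some neighborhood $W\subseteq U$ of $p$. (3) If $K^{\mathrm{ext}}\ge0$ on $U\setminus\Sigma$ for some neighborhood $U$ of $p$, then all singular principal curvatures at $p$ are $\le0$. Furthermore, if there are an open neighborhood $U$ of $p$, a smooth vector field $\tilde\eta$ on $U$ and a constant $\delta>0$ such that $\tilde\eta_q\ne0$ and $\varphi(\tilde\eta_q)=0$ for all $q\in U\cap\Sigma$, and $K^{\mathrm{ext}}(X\wedge\tilde\eta_q)\ge\delta$ for all $q\in U\setminus\Sigma$ and all $X\in T_qM$ with $X\wedge\tilde\eta_q\ne0$, then all singular principal curvatures at $p$ are $<0$. -/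

import Mathlib

open Bundle Set Filter Topology Manifold
open scoped ContDiff

namespace FrontBundles

noncomputable section

/-- A tuple `v` of vectors is a basis that is positive for the orientation `o`. -/
def IsPositiveFrame {m : ℕ} {W : Type*} [AddCommGroup W] [Module ℝ W]
    (o : Orientation ℝ W (Fin m)) (v : Fin m → W) : Prop :=
  ∃ b : Module.Basis (Fin m) ℝ W, ⇑b = v ∧ b.orientation = o

section Base

variable {k : ℕ} {M : Type*} [TopologicalSpace M]
  [ChartedSpace (EuclideanSpace ℝ (Fin (k + 1))) M]

/-- The coordinate vector `∂/∂u_j` at `x` of the coordinate system `e = (u_1, …, u_m)`. -/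
def coordVec (e : OpenPartialHomeomorph M (EuclideanSpace ℝ (Fin (k + 1)))) (j : Fin (k + 1))
    (x : M) : TangentSpace (𝓡 (k + 1)) x :=
  (mvfderiv (𝓡 (k + 1)) e x).inverse (EuclideanSpace.single j (1 : ℝ))

/-- `e` is a smooth local coordinate system compatible with a pointwise choice `o` of
orientations of the tangent spaces. -/
def IsPositiveChart (o : ∀ x : M, Orientation ℝ (TangentSpace (𝓡 (k + 1)) x) (Fin (k + 1)))
    (e : OpenPartialHomeomorph M (EuclideanSpace ℝ (Fin (k + 1)))) : Prop :=
  e ∈ IsManifold.maximalAtlas (𝓡 (k + 1)) ∞ M ∧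
    ∀ x ∈ e.source, IsPositiveFrame (o x) (fun j => coordVec e j x)

/-- `o` is an orientation of the manifold `M`: around every point there is a positive chart. -/
def IsManifoldOrientation
    (o : ∀ x : M, Orientation ℝ (TangentSpace (𝓡 (k + 1)) x) (Fin (k + 1))) : Prop :=
  ∀ p : M, ∃ e, p ∈ e.source ∧ IsPositiveChart o e

end Base

variable {k : ℕ} {M : Type*} [TopologicalSpace M]
  [ChartedSpace (EuclideanSpace ℝ (Fin (k + 1))) M]
  [IsManifold (𝓡 (k + 1)) ∞ M]
  {F : Type*} [NormedAddCommGroup F] [NormedSpace ℝ F] [FiniteDimensional ℝ F]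
  {V : M → Type*} [TopologicalSpace (TotalSpace F V)]
  [∀ x, NormedAddCommGroup (V x)] [∀ x, InnerProductSpace ℝ (V x)]
  [FiberBundle F V] [VectorBundle ℝ F V]
  [ContMDiffVectorBundle ∞ F V (𝓡 (k + 1))]
  [IsContMDiffRiemannianBundle (𝓡 (k + 1)) ∞ F V]

/-- `(M, V, ⟨,⟩, D, φ)` is a coherent tangent bundle: `V` has rank `m = k + 1 = dim M`, `D` is a
smooth metric connection, and `φ : TM → V` is a smooth bundle homomorphism with
`D_X φ(Y) - D_Y φ(X) - φ([X, Y]) = 0`. Note that `D σ x (X x)` is `(D_X σ)(x)`. -/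
structure IsCoherentTangentBundle (D : CovariantDerivative (𝓡 (k + 1)) F V)
    (φ : ∀ x : M, TangentSpace (𝓡 (k + 1)) x →L[ℝ] V x) : Prop where
  rank_eq : Module.finrank ℝ F = k + 1
  smooth_connection : CovariantDerivative.ContMDiffCovariantDerivative D ∞
  metric : D.IsMetricCompatible
  smooth_hom : ContMDiff (𝓡 (k + 1))
    ((𝓡 (k + 1)).prod 𝓘(ℝ, EuclideanSpace ℝ (Fin (k + 1)) →L[ℝ] F)) ∞
    (fun x => TotalSpace.mk' (EuclideanSpace ℝ (Fin (k + 1)) →L[ℝ] F) x (φ x))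
  coherent : ∀ (x : M) (X Y : ∀ y : M, TangentSpace (𝓡 (k + 1)) y),
    MDifferentiableAt (𝓡 (k + 1)) ((𝓡 (k + 1)).prod 𝓘(ℝ, EuclideanSpace ℝ (Fin (k + 1))))
      (fun y => TotalSpace.mk' (EuclideanSpace ℝ (Fin (k + 1))) y (X y)) x →
    MDifferentiableAt (𝓡 (k + 1)) ((𝓡 (k + 1)).prod 𝓘(ℝ, EuclideanSpace ℝ (Fin (k + 1))))
      (fun y => TotalSpace.mk' (EuclideanSpace ℝ (Fin (k + 1))) y (Y y)) x →
      D (fun y => φ y (Y y)) x (X x) - D (fun y => φ y (X y)) x (Y x)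
        - φ x (VectorField.mlieBracket (𝓡 (k + 1)) X Y x) = 0

/-- `(M, V, ⟨,⟩, D, φ, ψ)` is a front bundle. -/
structure IsFrontBundle (D : CovariantDerivative (𝓡 (k + 1)) F V)
    (φ ψ : ∀ x : M, TangentSpace (𝓡 (k + 1)) x →L[ℝ] V x) : Prop where
  coherent_fst : IsCoherentTangentBundle D φ
  coherent_snd : IsCoherentTangentBundle D ψ
  compatible : ∀ (x : M) (X Y : TangentSpace (𝓡 (k + 1)) x),
    inner ℝ (φ x X) (ψ x Y) = inner ℝ (φ x Y) (ψ x X)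
  front : ∀ (x : M) (X : TangentSpace (𝓡 (k + 1)) x), φ x X = 0 → ψ x X = 0 → X = 0

/-- A co-orientation: a smooth section `μ` of the determinant bundle of the dual of `V` which
takes the values `±1` on orthonormal frames. Smoothness is tested on smooth sections. -/
structure IsCoorientation (F : Type*) [NormedAddCommGroup F] [NormedSpace ℝ F]
    {V : M → Type*} [TopologicalSpace (TotalSpace F V)]
    [∀ x, NormedAddCommGroup (V x)] [∀ x, InnerProductSpace ℝ (V x)] [FiberBundle F V]
    (μ : ∀ x : M, V x [⋀^Fin (k + 1)]→ₗ[ℝ] ℝ) : Prop where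
  smooth : ∀ (s : Fin (k + 1) → ∀ x : M, V x) (p : M),
    (∀ i, ContMDiffAt (𝓡 (k + 1)) ((𝓡 (k + 1)).prod 𝓘(ℝ, F)) ∞
      (fun x => TotalSpace.mk' F x (s i x)) p) →
      ContMDiffAt (𝓡 (k + 1)) 𝓘(ℝ, ℝ) ∞ (fun x => μ x (fun i => s i x)) p
  unit : ∀ (x : M) (v : Fin (k + 1) → V x), Orthonormal ℝ v → μ x v = 1 ∨ μ x v = -1

section Pointwise

variable {k : ℕ} {M : Type*} [TopologicalSpace M]
  [ChartedSpace (EuclideanSpace ℝ (Fin (k + 1))) M]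
  {V : M → Type*} [∀ x, NormedAddCommGroup (V x)] [∀ x, InnerProductSpace ℝ (V x)]

/-- The singular set `Σ_φ`. -/
def singularSet (φ : ∀ x : M, TangentSpace (𝓡 (k + 1)) x →L[ℝ] V x) : Set M :=
  {x | ¬ Function.Bijective (φ x)}

/-- The first fundamental form `I`, i.e. the `φ`-metric. -/
def formI (φ : ∀ x : M, TangentSpace (𝓡 (k + 1)) x →L[ℝ] V x) (x : M)
    (X Y : TangentSpace (𝓡 (k + 1)) x) : ℝ :=
  inner ℝ (φ x X) (φ x Y)

/-- The second fundamental form `II`. -/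
def formII (φ ψ : ∀ x : M, TangentSpace (𝓡 (k + 1)) x →L[ℝ] V x) (x : M)
    (X Y : TangentSpace (𝓡 (k + 1)) x) : ℝ :=
  -inner ℝ (φ x X) (ψ x Y)

/-- The extrinsic curvature `K^ext(X ∧ Y)` at a regular point `x` of `φ`, for linearly
independent `X, Y`. -/
def extCurv (φ ψ : ∀ x : M, TangentSpace (𝓡 (k + 1)) x →L[ℝ] V x) (x : M)
    (X Y : TangentSpace (𝓡 (k + 1)) x) : ℝ :=
  (formII φ ψ x X X * formII φ ψ x Y Y - formII φ ψ x X Y ^ 2) /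
    (formI φ x X X * formI φ x Y Y - formI φ x X Y ^ 2)

/-- The property `P` holds for `K^ext` of every tangent plane at every point of `U \ Σ_φ`. -/
def ExtCurvOn (φ ψ : ∀ x : M, TangentSpace (𝓡 (k + 1)) x →L[ℝ] V x) (U : Set M)
    (P : ℝ → Prop) : Prop :=
  ∀ q ∈ U \ singularSet φ, ∀ X Y : TangentSpace (𝓡 (k + 1)) q,
    LinearIndependent ℝ ![X, Y] → P (extCurv φ ψ q X Y)

/-- The `φ`-Jacobian function `λ_φ = μ(φ(∂_1), …, φ(∂_m))` in the coordinate system `e`. -/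
def jacobian (μ : ∀ x : M, V x [⋀^Fin (k + 1)]→ₗ[ℝ] ℝ)
    (φ : ∀ x : M, TangentSpace (𝓡 (k + 1)) x →L[ℝ] V x)
    (e : OpenPartialHomeomorph M (EuclideanSpace ℝ (Fin (k + 1)))) (x : M) : ℝ :=
  μ x (fun j => φ x (coordVec e j x))

/-- The differential `dλ_φ` at `x`. -/
def dJacobian (μ : ∀ x : M, V x [⋀^Fin (k + 1)]→ₗ[ℝ] ℝ)
    (φ : ∀ x : M, TangentSpace (𝓡 (k + 1)) x →L[ℝ] V x)
    (e : OpenPartialHomeomorph M (EuclideanSpace ℝ (Fin (k + 1)))) (x : M) :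
    TangentSpace (𝓡 (k + 1)) x →L[ℝ] ℝ :=
  mvfderiv (𝓡 (k + 1)) (jacobian μ φ e) x

/-- The tangent space `T_xΣ_φ` of the singular submanifold `Σ_φ = {λ_φ = 0}` at a
non-degenerate singular point `x`, as the kernel of `dλ_φ` at `x`. -/
def singularTangent (μ : ∀ x : M, V x [⋀^Fin (k + 1)]→ₗ[ℝ] ℝ)
    (φ : ∀ x : M, TangentSpace (𝓡 (k + 1)) x →L[ℝ] V x)
    (e : OpenPartialHomeomorph M (EuclideanSpace ℝ (Fin (k + 1)))) (x : M) :
    Submodule ℝ (TangentSpace (𝓡 (k + 1)) x) :=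
  (dJacobian μ φ e x).ker

/-- `p` is an `A_2`-point of `φ`: a non-degenerate singular point at which the null direction is
transversal to the singular submanifold. (The conditions do not depend on the positive
chart.) -/
def IsA2Point (o : ∀ x : M, Orientation ℝ (TangentSpace (𝓡 (k + 1)) x) (Fin (k + 1)))
    (μ : ∀ x : M, V x [⋀^Fin (k + 1)]→ₗ[ℝ] ℝ)
    (φ : ∀ x : M, TangentSpace (𝓡 (k + 1)) x →L[ℝ] V x) (p : M) : Prop :=
  p ∈ singularSet φ ∧ ∃ e, p ∈ e.source ∧ IsPositiveChart o e ∧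
    dJacobian μ φ e p ≠ 0 ∧ (φ p).ker ⊔ singularTangent μ φ e p = ⊤

end Pointwise

/-- The choices made in the definition of the singular shape operator at an `A_2`-point `p`. -/
structure AdaptedFrame (F : Type*) [NormedAddCommGroup F] [NormedSpace ℝ F]
    {V : M → Type*} [TopologicalSpace (TotalSpace F V)]
    [∀ x, NormedAddCommGroup (V x)] [∀ x, InnerProductSpace ℝ (V x)] [FiberBundle F V]
    (o : ∀ x : M, Orientation ℝ (TangentSpace (𝓡 (k + 1)) x) (Fin (k + 1)))
    (μ : ∀ x : M, V x [⋀^Fin (k + 1)]→ₗ[ℝ] ℝ)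
    (φ : ∀ x : M, TangentSpace (𝓡 (k + 1)) x →L[ℝ] V x) (p : M) where
  /-- A local coordinate system compatible with the orientation. -/
  chart : OpenPartialHomeomorph M (EuclideanSpace ℝ (Fin (k + 1)))
  chart_pos : IsPositiveChart o chart
  /-- A neighborhood of `p`. -/
  dom : Set M
  dom_open : IsOpen dom
  mem_dom : p ∈ dom
  dom_subset : dom ⊆ chart.source
  /-- A smooth frame `e_1, …, e_{m-1}`, orthonormal for the `φ`-metric and tangent to the
  singular set along it. -/
  vec : Fin k → ∀ x : M, TangentSpace (𝓡 (k + 1)) x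
  vec_smooth : ∀ i, ContMDiffOn (𝓡 (k + 1))
    ((𝓡 (k + 1)).prod 𝓘(ℝ, EuclideanSpace ℝ (Fin (k + 1)))) ∞
    (fun x => TotalSpace.mk' (EuclideanSpace ℝ (Fin (k + 1))) x (vec i x)) dom
  vec_orthonormal : ∀ q ∈ dom, ∀ i j,
    formI φ q (vec i q) (vec j q) = if i = j then 1 else 0
  vec_tangent : ∀ q ∈ dom ∩ singularSet φ, ∀ i, vec i q ∈ singularTangent μ φ chart q
  /-- The conormal vector field `n`: the frame `(φ(e_1), …, φ(e_{m-1}), n)` is orthonormal and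
  positive. -/
  conormal : ∀ x : M, V x
  conormal_smooth : ContMDiffOn (𝓡 (k + 1)) ((𝓡 (k + 1)).prod 𝓘(ℝ, F)) ∞
    (fun x => TotalSpace.mk' F x (conormal x)) dom
  frame_orthonormal : ∀ q ∈ dom, Orthonormal ℝ
    (Fin.snoc (α := fun _ => V q) (fun i => φ q (vec i q)) (conormal q))
  frame_pos : ∀ q ∈ dom,
    μ q (Fin.snoc (α := fun _ => V q) (fun i => φ q (vec i q)) (conormal q)) = 1
  /-- The null vector `η` at `p` such that `(e_1, …, e_{m-1}, η)` is positive. -/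
  null : TangentSpace (𝓡 (k + 1)) p
  null_mem : φ p null = 0
  null_pos : IsPositiveFrame (o p)
    (Fin.snoc (α := fun _ => TangentSpace (𝓡 (k + 1)) p) (fun i => vec i p) null)

/-- The singular shape operator `S_φ(X) = -sgn(dλ_φ(η)) φ⁻¹(D_X n)` on `T_pΣ_φ`, where `φ⁻¹` is
the inverse of the restriction of `φ` to `T_pΣ_φ`. -/
def AdaptedFrame.shapeOperator
    {o : ∀ x : M, Orientation ℝ (TangentSpace (𝓡 (k + 1)) x) (Fin (k + 1))}
    {μ : ∀ x : M, V x [⋀^Fin (k + 1)]→ₗ[ℝ] ℝ}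
    {φ : ∀ x : M, TangentSpace (𝓡 (k + 1)) x →L[ℝ] V x} {p : M}
    (A : AdaptedFrame F o μ φ p) (D : CovariantDerivative (𝓡 (k + 1)) F V) :
    singularTangent μ φ A.chart p →ₗ[ℝ] singularTangent μ φ A.chart p :=
  (-Real.sign (dJacobian μ φ A.chart p A.null)) •
    (((φ p).toLinearMap.domRestrict (singularTangent μ φ A.chart p)).leftInverse ∘ₗ
      (D A.conormal p).toLinearMap.domRestrict (singularTangent μ φ A.chart p))

/-- `c` is a singular principal curvature at `p`, i.e. an eigenvalue of the singular shape
operator (which does not depend on the choice of the adapted frame). -/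
def IsSingularPrincipalCurvature (D : CovariantDerivative (𝓡 (k + 1)) F V)
    (o : ∀ x : M, Orientation ℝ (TangentSpace (𝓡 (k + 1)) x) (Fin (k + 1)))
    (μ : ∀ x : M, V x [⋀^Fin (k + 1)]→ₗ[ℝ] ℝ)
    (φ : ∀ x : M, TangentSpace (𝓡 (k + 1)) x →L[ℝ] V x) (p : M) (c : ℝ) : Prop :=
  ∃ A : AdaptedFrame F o μ φ p, Module.End.HasEigenvalue (A.shapeOperator D) c

end

end FrontBundles

/-! Cramer's rule, applied to `φ` in coordinates, attaches to a section `n` of the bundle the smooth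
field η = `cofactorField μ φ e n` with φ(η) = λn, where λ is the Jacobian function
(`map_cofactorField`). At `p` choose `n` equal to ψ of a null vector. By compatibility this value is
orthogonal to the image of `φ`, and η then spans the kernel of `φ` at `p`, with ρ = ⟨n, ψη⟩ nonzero
there. For every field X, with f = ⟨φX, ψX⟩, the numerator of the curvature of X ∧ η is λ(fρ − λ⟨n,
ψX⟩²), while the denominator is λ² times the Gram determinant of φX and n. So the curvature has a
simple pole along λ = 0 unless f vanishes there.

Boundedness excludes the pole at `p`, so f(p) = 0, and polarization gives the vanishing of the
second fundamental form. If the curvature has a sign, then fρ − λ⟨n, ψX⟩² has to change sign with λ,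
which takes both signs near each of its zeros close to `p`; hence f = 0 along the singular set. By
Hadamard's lemma (`HasStrictFDerivAt.isBigO_of_eventually_zero`) all coefficients ⟨φ∂ᵢ, ψ∂ⱼ⟩ are
then O(λ). This makes the curvature bounded on all planes, since `φ` degenerates only to first order
and in one direction (`abs_gram_le_of_bounds`).

For the principal curvatures, take `n` to be the conormal and let ζ be a field that is null along
the singular set. Divide K(X ∧ ζ) ≥ δ, with denominators cleared, by λ² and let the point tend to
`p` transversally to the singular set. With d = dλ(η), the result is δ|φX|² ≤ (df(η)/d)ρ
(`mul_inner_le_of_mul_extDen_le`). For X tangent to the singular set, the coherence of `φ` and `ψ`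
gives df(η) = ρ⟨φX, D_X n⟩ (`mvfderiv_inner_null`). For an eigenvector with eigenvalue c the right
side is −(ρ²/|d|)c|φX|². Taking δ = 0 yields c ≤ 0, and δ > 0 yields c < 0. -/

section Analysis

/-! ### Real functions near a regular zero, in a normed space. -/

variable {E : Type*} [NormedAddCommGroup E] [NormedSpace ℝ E]

/-- A strictly differentiable function grows at a rate close to its derivative along a fixed
direction, uniformly near the base point. -/
theorem HasStrictFDerivAt.eventually_abs_sub_le_along {g : E → ℝ} {L : E →L[ℝ] ℝ} {x₀ v : E}
    (hg : HasStrictFDerivAt g L x₀) (hv : L v = 1) :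
    ∀ᶠ z : E × ℝ in 𝓝 (x₀, 0), |g (z.1 + z.2 • v) - g z.1 - z.2| ≤ |z.2| / 2 := by
  have hv0 : 0 < ‖v‖ := norm_pos_iff.2 (by rintro rfl; simp at hv)
  -- This constant turns the error bound at displacement `z.2 • v` into exactly `|z.2| / 2`.
  have h := (hasStrictFDerivAt_iff_isLittleO.1 hg).def (c := 1 / (2 * ‖v‖)) (by positivity)
  have ht : Tendsto (fun z : E × ℝ => (z.1 + z.2 • v, z.1)) (𝓝 (x₀, 0)) (𝓝 (x₀, x₀)) := by
    have : Continuous (fun z : E × ℝ => (z.1 + z.2 • v, z.1)) := by fun_prop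
    simpa using this.tendsto (x₀, 0)
  filter_upwards [ht.eventually h] with z hz
  simp only [add_sub_cancel_left, map_smul, hv, smul_eq_mul, mul_one, norm_smul,
    Real.norm_eq_abs] at hz
  refine hz.trans (le_of_eq ?_)
  field_simp

/-- A function vanishing on the zero set of a submersion is locally dominated by it. -/
theorem HasStrictFDerivAt.isBigO_of_eventually_zero {f g : E → ℝ} {K L : E →L[ℝ] ℝ} {x₀ : E}
    (hf : HasStrictFDerivAt f K x₀) (hg : HasStrictFDerivAt g L x₀) (hL : L ≠ 0)
    (hg0 : g x₀ = 0) (hfg : ∀ᶠ x in 𝓝 x₀, g x = 0 → f x = 0) : f =O[𝓝 x₀] g := by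
  obtain ⟨w, hw⟩ : ∃ w, L w ≠ 0 := by
    by_contra! h
    exact hL (ContinuousLinearMap.ext h)
  set v : E := (L w)⁻¹ • w with hvdef
  have hv : L v = 1 := by simp [hvdef, hw]
  obtain ⟨C, s, hs, hC⟩ := hf.exists_lipschitzOnWith
  have hcont : ∀ᶠ x in 𝓝 x₀, ContinuousAt g x := by
    obtain ⟨C', s', hs', hC'⟩ := hg.exists_lipschitzOnWith
    filter_upwards [eventually_mem_nhds_iff.2 hs'] with x hx
    exact hC'.continuousOn.continuousAt hx
  have key := (hg.eventually_abs_sub_le_along hv)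
  have ht : Tendsto (fun z : E × ℝ => z.1 + z.2 • v) (𝓝 (x₀, 0)) (𝓝 x₀) := by
    have : Continuous (fun z : E × ℝ => z.1 + z.2 • v) := by fun_prop
    simpa using this.tendsto (x₀, 0)
  have hall : ∀ᶠ z : E × ℝ in 𝓝 (x₀, 0), |g (z.1 + z.2 • v) - g z.1 - z.2| ≤ |z.2| / 2 ∧
      (z.1 + z.2 • v ∈ s) ∧ ContinuousAt g (z.1 + z.2 • v) ∧
      (g (z.1 + z.2 • v) = 0 → f (z.1 + z.2 • v) = 0) := by
    filter_upwards [key, ht.eventually hs, ht.eventually hcont, ht.eventually hfg] with z a b c d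
    exact ⟨a, b, c, d⟩
  rw [nhds_prod_eq, (Filter.basis_sets (𝓝 x₀)).prod (Metric.nhds_basis_ball (x := (0 : ℝ)))
    |>.eventually_iff] at hall
  obtain ⟨⟨t, r⟩, ⟨ht0, hr⟩, hall⟩ := hall
  change t ∈ 𝓝 x₀ at ht0
  refine Asymptotics.IsBigO.of_bound (C * (2 * ‖v‖)) ?_
  have hsmall : ∀ᶠ x in 𝓝 x₀, |2 * g x| < r := by
    have : ContinuousAt (fun x => |2 * g x|) x₀ :=
      (continuousAt_const.mul hcont.self_of_nhds).abs
    exact this.eventually_lt continuousAt_const (by simpa [hg0] using hr)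
  filter_upwards [ht0, hsmall] with x hx hxr
  have hmem : ∀ τ ∈ uIcc 0 (-(2 * g x)), (x, τ) ∈ t ×ˢ Metric.ball (0 : ℝ) r := by
    intro τ hτ
    refine ⟨hx, ?_⟩
    rw [Metric.mem_ball, dist_zero_right, Real.norm_eq_abs]
    refine lt_of_le_of_lt ?_ hxr
    have := abs_sub_left_of_mem_uIcc hτ
    simpa using this
  -- A step of `-2 g x` along `v` would change `g` by `-2 g x` up to an error `|g x|`, which is
  -- enough to reach or cross zero. The Lipschitz bound of `f` on the way to that zero then gives
  -- the estimate.
  have hivt : ∃ τ ∈ uIcc 0 (-(2 * g x)), g (x + τ • v) = 0 := by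
    have hc : ContinuousOn (fun τ : ℝ => g (x + τ • v)) (uIcc 0 (-(2 * g x))) := by
      intro τ hτ
      have h1 := (hall (hmem τ hτ)).2.2.1
      have h2 : ContinuousAt (fun τ : ℝ => x + τ • v) τ := by fun_prop
      exact (ContinuousAt.comp (f := fun τ : ℝ => x + τ • v) h1 h2).continuousWithinAt
    have h0 : (0 : ℝ) ∈ uIcc (g (x + (0 : ℝ) • v)) (g (x + (-(2 * g x)) • v)) := by
      have h3 := (hall (hmem _ right_mem_uIcc)).1
      rw [abs_le] at h3
      simp only [zero_smul, add_zero]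
      rcases le_total 0 (g x) with h | h
      · rw [abs_neg, abs_of_nonneg (by linarith : 0 ≤ 2 * g x)] at h3
        exact mem_uIcc_of_ge (by linarith) h
      · rw [abs_neg, abs_of_nonpos (by linarith : 2 * g x ≤ 0)] at h3
        exact mem_uIcc_of_le h (by linarith)
    exact intermediate_value_uIcc hc h0
  obtain ⟨τ, hτ, hgτ⟩ := hivt
  have h1 := hall (hmem τ hτ)
  have h2 := hall (hmem 0 left_mem_uIcc)
  have hfz := h1.2.2.2 hgτ
  have hτ' : |τ| ≤ 2 * |g x| := by
    have := abs_sub_left_of_mem_uIcc hτ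
    simpa [abs_mul] using this
  have hl := hC.dist_le_mul x (by simpa using h2.2.1) _ h1.2.1
  rw [Real.dist_eq, hfz, sub_zero, dist_self_add_right, norm_smul, Real.norm_eq_abs] at hl
  rw [Real.norm_eq_abs, Real.norm_eq_abs]
  calc |f x| ≤ C * (|τ| * ‖v‖) := hl
    _ ≤ C * (2 * |g x| * ‖v‖) := by gcongr
    _ = C * (2 * ‖v‖) * |g x| := by ring

/-- Near a regular point, a function takes both signs close to each of its zeros. -/
theorem HasStrictFDerivAt.eventually_frequently_pos_neg {g : E → ℝ} {L : E →L[ℝ] ℝ} {x₀ : E}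
    (hg : HasStrictFDerivAt g L x₀) (hL : L ≠ 0) :
    ∀ᶠ x in 𝓝 x₀, g x = 0 → (∃ᶠ y in 𝓝 x, 0 < g y) ∧ ∃ᶠ y in 𝓝 x, g y < 0 := by
  obtain ⟨w, hw⟩ : ∃ w, L w ≠ 0 := by
    by_contra! h
    exact hL (ContinuousLinearMap.ext h)
  set v : E := (L w)⁻¹ • w with hvdef
  have hv : L v = 1 := by simp [hvdef, hw]
  have key := hg.eventually_abs_sub_le_along hv
  rw [nhds_prod_eq] at key
  filter_upwards [key.curry] with x hx hgx
  have ht : Tendsto (fun τ : ℝ => x + τ • v) (𝓝 0) (𝓝 x) := by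
    have : Continuous (fun τ : ℝ => x + τ • v) := by fun_prop
    simpa using this.tendsto 0
  constructor
  · have : ∃ᶠ τ : ℝ in 𝓝 0, 0 < g (x + τ • v) := by
      have h : ∀ᶠ τ : ℝ in 𝓝[>] 0, 0 < g (x + τ • v) := by
        filter_upwards [hx.filter_mono nhdsWithin_le_nhds, self_mem_nhdsWithin] with τ h1 h2
        replace h2 : 0 < τ := h2
        rw [hgx, _root_.abs_of_pos h2, abs_le] at h1
        linarith [h1.1]
      exact h.frequently.filter_mono nhdsWithin_le_nhds
    exact ht.frequently this
  · have : ∃ᶠ τ : ℝ in 𝓝 0, g (x + τ • v) < 0 := by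
      have h : ∀ᶠ τ : ℝ in 𝓝[<] 0, g (x + τ • v) < 0 := by
        filter_upwards [hx.filter_mono nhdsWithin_le_nhds, self_mem_nhdsWithin] with τ h1 h2
        replace h2 : τ < 0 := h2
        rw [hgx, _root_.abs_of_neg h2, abs_le] at h1
        linarith [h1.2]
      exact h.frequently.filter_mono nhdsWithin_le_nhds
    exact ht.frequently this

end Analysis

/-! ### The same facts on a manifold, and limits along curves. -/

section ManifoldAnalysis

variable {E : Type*} [NormedAddCommGroup E] [NormedSpace ℝ E]
  {H : Type*} [TopologicalSpace H] {I : ModelWithCorners ℝ E H} [I.Boundaryless]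
  {M : Type*} [TopologicalSpace M] [ChartedSpace H M] {p : M}

theorem MDifferentiableAt.hasFDerivAt_comp_extChartAt_symm {f : M → ℝ}
    (hf : MDifferentiableAt I 𝓘(ℝ, ℝ) f p) :
    HasFDerivAt (f ∘ (extChartAt I p).symm) (mvfderiv I f p) (extChartAt I p p) := by
  have h := hf.differentiableWithinAt_writtenInExtChartAt
  have h2 := hf.mvfderiv
  simp only [I.range_eq_univ, fderivWithin_univ, differentiableWithinAt_univ] at h h2
  rw [h2]
  exact h.hasFDerivAt

theorem ContMDiffAt.hasStrictFDerivAt_comp_extChartAt_symm {f : M → ℝ} {n : ℕ∞ω}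
    (hf : ContMDiffAt I 𝓘(ℝ, ℝ) n f p) (hn : n ≠ 0) :
    HasStrictFDerivAt (f ∘ (extChartAt I p).symm) (mvfderiv I f p) (extChartAt I p p) := by
  have h := (contMDiffAt_iff.1 hf).2
  simp only [I.range_eq_univ, contDiffWithinAt_univ] at h
  have h3 := (hf.mdifferentiableAt hn).hasFDerivAt_comp_extChartAt_symm
  exact ContDiffAt.hasStrictFDerivAt' h h3 hn

theorem eventually_nhds_iff_extChartAt_symm {P : M → Prop} :
    (∀ᶠ q in 𝓝 p, P q) ↔ ∀ᶠ x in 𝓝 (extChartAt I p p), P ((extChartAt I p).symm x) := by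
  rw [← map_extChartAt_symm_nhdsWithin_range (I := I) p, I.range_eq_univ, nhdsWithin_univ,
    eventually_map]

theorem ContMDiffAt.isBigO_of_eventually_zero {f g : M → ℝ} {n : ℕ∞ω}
    (hf : ContMDiffAt I 𝓘(ℝ, ℝ) n f p) (hg : ContMDiffAt I 𝓘(ℝ, ℝ) n g p) (hn : n ≠ 0)
    (hdg : mvfderiv I g p ≠ 0) (hg0 : g p = 0) (hfg : ∀ᶠ q in 𝓝 p, g q = 0 → f q = 0) :
    f =O[𝓝 p] g := by
  have h := (hf.hasStrictFDerivAt_comp_extChartAt_symm hn).isBigO_of_eventually_zero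
    (hg.hasStrictFDerivAt_comp_extChartAt_symm hn) hdg (by simpa using hg0)
    (eventually_nhds_iff_extChartAt_symm.1 hfg)
  obtain ⟨C, hC⟩ := h.bound
  exact .of_bound C (eventually_nhds_iff_extChartAt_symm.2 hC)

theorem ContMDiffAt.eventually_frequently_pos_neg {g : M → ℝ} {n : ℕ∞ω}
    (hg : ContMDiffAt I 𝓘(ℝ, ℝ) n g p) (hn : n ≠ 0) (hdg : mvfderiv I g p ≠ 0) :
    ∀ᶠ q in 𝓝 p, g q = 0 → (∃ᶠ y in 𝓝 q, 0 < g y) ∧ ∃ᶠ y in 𝓝 q, g y < 0 := by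
  have h := (hg.hasStrictFDerivAt_comp_extChartAt_symm hn).eventually_frequently_pos_neg hdg
  have htgt : ∀ᶠ x in 𝓝 (extChartAt I p p), x ∈ (extChartAt I p).target :=
    extChartAt_target_mem_nhds p
  rw [eventually_nhds_iff_extChartAt_symm (I := I)]
  filter_upwards [h, htgt] with x hx hxt hgx
  have ht := continuousAt_extChartAt_symm'' (I := I) hxt
  exact ⟨ht.tendsto.frequently (hx hgx).1, ht.tendsto.frequently (hx hgx).2⟩

/-- Every tangent vector is the velocity of a curve. -/
theorem exists_curve_hasDerivAt (v : TangentSpace I p) :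
    ∃ γ : ℝ → M, Tendsto γ (𝓝 0) (𝓝 p) ∧ γ 0 = p ∧ ∀ f : M → ℝ,
      MDifferentiableAt I 𝓘(ℝ, ℝ) f p → HasDerivAt (f ∘ γ) (mvfderiv I f p v) 0 := by
  let w : E := v
  let c : ℝ → E := fun t => extChartAt I p p + t • w
  have hc : HasDerivAt c w 0 := by
    simpa [c] using ((hasDerivAt_id (0 : ℝ)).smul_const w).const_add (extChartAt I p p)
  have hc0 : c 0 = extChartAt I p p := by simp [c]
  refine ⟨(extChartAt I p).symm ∘ c, ?_, by simp [hc0], fun f hf => ?_⟩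
  · have h1 := continuousAt_extChartAt_symm (I := I) p
    rw [← hc0] at h1
    have := h1.comp hc.continuousAt
    simpa [ContinuousAt, hc0] using this
  · have h1 := hf.hasFDerivAt_comp_extChartAt_symm
    rw [← hc0] at h1
    exact h1.comp_hasDerivAt 0 hc

/-- Limits of quotients along a direction transversal to the zero set of the denominator. -/
theorem exists_filter_tendsto_div {g : M → ℝ} (hg : MDifferentiableAt I 𝓘(ℝ, ℝ) g p)
    (hg0 : g p = 0) {v : TangentSpace I p} (hv : mvfderiv I g p v ≠ 0) :
    ∃ l : Filter M, l.NeBot ∧ l ≤ 𝓝 p ∧ (∀ᶠ q in l, g q ≠ 0) ∧ ∀ f : M → ℝ,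
      MDifferentiableAt I 𝓘(ℝ, ℝ) f p → f p = 0 →
        Tendsto (fun q => f q / g q) l (𝓝 (mvfderiv I f p v / mvfderiv I g p v)) := by
  obtain ⟨γ, hγ, hγ0, hd⟩ := exists_curve_hasDerivAt v
  have hq : ∀ f : M → ℝ, MDifferentiableAt I 𝓘(ℝ, ℝ) f p → f p = 0 →
      Tendsto (fun t : ℝ => t⁻¹ * f (γ t)) (𝓝[≠] 0) (𝓝 (mvfderiv I f p v)) := by
    intro f hf hf0
    have := (hasDerivAt_iff_tendsto_slope_zero.1 (hd f hf))
    simpa [hγ0, hf0] using this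
  -- A single filter serves all numerators: several quotients will later be multiplied inside one
  -- limit. Along γ both `f` and `g` are asymptotically linear in the parameter, which cancels in
  -- the quotient.
  refine ⟨map γ (𝓝[≠] 0), inferInstance, (map_mono nhdsWithin_le_nhds).trans hγ, ?_, ?_⟩
  · rw [eventually_map]
    filter_upwards [(hq g hg hg0).eventually_ne hv] with t ht h0
    simp [h0] at ht
  · intro f hf hf0
    rw [tendsto_map'_iff]
    refine ((hq f hf hf0).div (hq g hg hg0) hv).congr' ?_
    filter_upwards [self_mem_nhdsWithin] with t ht
    have ht : t ≠ 0 := ht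
    simp only [Function.comp_apply, Pi.div_apply]
    field_simp

/-- Along a curve with velocity `v` the function `g` is o(t), hence so is `f`. With `g` = λ this
differentiates identities valid only on the singular set in directions tangent to it. -/
theorem mvfderiv_eq_zero_of_isBigO {f g : M → ℝ} (hf : MDifferentiableAt I 𝓘(ℝ, ℝ) f p)
    (hg : MDifferentiableAt I 𝓘(ℝ, ℝ) g p) (hg0 : g p = 0) (hfg : f =O[𝓝 p] g)
    {v : TangentSpace I p} (hv : mvfderiv I g p v = 0) : mvfderiv I f p v = 0 := by
  obtain ⟨γ, hγ, hγ0, hd⟩ := exists_curve_hasDerivAt v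
  have hf0 : f p = 0 := by
    obtain ⟨C, hC⟩ := hfg.bound
    simpa [hg0] using hC.self_of_nhds
  have h1 : HasDerivAt (f ∘ γ) 0 0 := by
    have h2 := hd g hg
    rw [hv, hasDerivAt_iff_isLittleO] at h2
    rw [hasDerivAt_iff_isLittleO]
    simp only [Function.comp_apply, hγ0, hf0, hg0, sub_zero, smul_zero] at h2 ⊢
    exact (hfg.comp_tendsto hγ).trans_isLittleO h2
  exact (hd f hf).unique h1

end ManifoldAnalysis

/-! ### Alternating forms, Cramer's rule and cofactor vectors. -/

section Alternating

variable {m : ℕ} {W : Type*} [AddCommGroup W] [Module ℝ W]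

/-- Adding multiples of a vector that occurs as an argument does not change the value of an
alternating map. -/
theorem AlternatingMap.map_update_eq_of_sub_mem_span (ν : W [⋀^Fin m]→ₗ[ℝ] ℝ) (i : Fin m)
    (n : W) (v w : Fin m → W) (h : ∀ j, ∃ c : ℝ, v j = w j + c • n) :
    ν (Function.update v i n) = ν (Function.update w i n) := by
  classical
  -- The slots are changed one at a time. Each change adds a multiple of a value with `n` in two
  -- slots.
  suffices H : ∀ s : Finset (Fin m),
      ν (Function.update (fun j => if j ∈ s then v j else w j) i n)
        = ν (Function.update w i n) by
    simpa using H Finset.univ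
  intro s
  induction s using Finset.induction_on with
  | empty => simp
  | insert a s ha ih =>
    rw [← ih]
    set u : Fin m → W := fun j => if j ∈ s then v j else w j with hu
    have hins : (fun j => if j ∈ insert a s then v j else w j) = Function.update u a (v a) := by
      funext j
      by_cases hj : j = a
      · subst hj; simp
      · simp [hu, hj]
    rw [hins]
    by_cases hia : a = i
    · subst hia; simp
    obtain ⟨c, hc⟩ := h a
    have hua : u a = w a := by simp [hu, ha]
    have h0 : ν (Function.update (Function.update u i n) a n) = 0 :=
      ν.map_eq_zero_of_eq (i := a) (j := i) _ (by simp [Ne.symm hia]) hia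
    rw [Function.update_comm hia, hc, ν.map_update_add, ν.map_update_smul, h0, smul_zero,
      add_zero, ← hua, Function.update_comm (Ne.symm hia), Function.update_eq_self]

theorem AlternatingMap.map_update_sum_smul (ν : W [⋀^Fin m]→ₗ[ℝ] ℝ) (v : Fin m → W)
    (a : Fin m → ℝ) (j : Fin m) :
    ν (Function.update v j (∑ l, a l • v l)) = a j * ν v := by
  classical
  rw [ν.map_update_sum, Finset.sum_eq_single j]
  · rw [ν.map_update_smul, Function.update_eq_self, smul_eq_mul]
  · intro l _ hl
    rw [ν.map_update_smul, ν.map_update_self _ (Ne.symm hl), smul_zero]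
  · simp

/-- Cramer's rule. -/
theorem AlternatingMap.sum_map_update_smul (b : Module.Basis (Fin m) ℝ W)
    (ν : W [⋀^Fin m]→ₗ[ℝ] ℝ) (v : Fin m → W) (u : W) :
    ∑ i, ν (Function.update v i u) • v i = ν v • u := by
  classical
  -- In top degree `ν` is a multiple of the determinant, so the matrix form of Cramer's rule
  -- applies.
  have hν : ∀ w, ν w = ν b * (b.toMatrix w).det := fun w => by
    conv_lhs => rw [ν.eq_smul_basis_det b]
    simp [Module.Basis.det_apply]
  have hup : ∀ i, b.toMatrix (Function.update v i u) = (b.toMatrix v).updateCol i (b.repr u) :=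
    fun i => b.toMatrix_update v i u
  have h := Matrix.mulVec_cramer (b.toMatrix v) (b.repr u)
  apply b.repr.injective
  ext l
  have hl := congrFun h l
  simp only [Matrix.mulVec, dotProduct, Matrix.cramer_apply, Pi.smul_apply, smul_eq_mul] at hl
  simp only [map_sum, map_smul, Finsupp.coe_finsetSum, Finset.sum_apply, Finsupp.smul_apply,
    smul_eq_mul]
  calc _ = ν b * ∑ i, b.toMatrix v l i * ((b.toMatrix v).updateCol i (b.repr u)).det := by
        rw [Finset.mul_sum]
        refine Finset.sum_congr rfl fun i _ => ?_
        rw [Module.Basis.toMatrix_apply, hν, hup]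
        ring
    _ = _ := by rw [hl, hν v]; ring

/-- Comparison of the cofactor vector of a singular homomorphism with a null vector completing
a basis. -/
theorem AlternatingMap.cofactor_eq_smul_null {V : Type*} [AddCommGroup V] [Module ℝ V] {k : ℕ}
    (ν : V [⋀^Fin (k + 1)]→ₗ[ℝ] ℝ) (T : W →ₗ[ℝ] V) (b B : Module.Basis (Fin (k + 1)) ℝ W)
    (n : V) (hT : T (B (Fin.last k)) = 0)
    (hν : ν (Fin.snoc (α := fun _ => V) (fun i => T (B i.castSucc)) n) = 1) :
    ∑ i, ν (Function.update (fun j => T (b j)) i n) • b i = (b.det B)⁻¹ • B (Fin.last k) := by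
  classical
  -- The map `T'` sends the null vector to `n` and agrees with `T` modulo `n`. It therefore has the
  -- same cofactors with respect to `n`, and these are now the coordinates of the null vector in
  -- `b`, up to a common factor. The factor is `(b.det B)⁻¹` because `ν` takes the value 1 on `T' ∘
  -- B`.
  set T' : W →ₗ[ℝ] V := T + (B.coord (Fin.last k)).smulRight n with hT'
  have hT'B : T' (B (Fin.last k)) = n := by simp [hT', hT]
  have hcast : ∀ i : Fin k, T' (B i.castSucc) = T (B i.castSucc) := fun i => by
    simp [hT', (Fin.castSucc_lt_last i).ne]
  have hfun : (fun j => T' (B j)) = Fin.snoc (α := fun _ => V) (fun i => T (B i.castSucc)) n := by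
    funext j
    refine Fin.lastCases ?_ (fun i => ?_) j
    · simp [hT'B]
    · simp [hcast]
  have hone : ν (fun j => T' (b j)) * b.det B = 1 := by
    have h1 := congrArg (fun g => g B) ((ν.compLinearMap T').eq_smul_basis_det b)
    have h2 : ν (fun j => T' (B j)) = ν (fun j => T' (b j)) * b.det B := h1
    rw [← h2, hfun, hν]
  have hi : ∀ i, ν (Function.update (fun j => T (b j)) i n)
      = ν (fun j => T' (b j)) * b.repr (B (Fin.last k)) i := by
    intro i
    have h1 : ν (Function.update (fun j => T (b j)) i n)
        = ν (Function.update (fun j => T' (b j)) i n) := by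
      refine (ν.map_update_eq_of_sub_mem_span i n _ _ fun j => ?_).symm
      exact ⟨B.coord (Fin.last k) (b j), by simp [hT']⟩
    have h2 : n = ∑ l, b.repr (B (Fin.last k)) l • T' (b l) := by
      rw [← hT'B]
      conv_lhs => rw [← b.sum_repr (B (Fin.last k))]
      rw [map_sum]
      simp
    rw [h1]
    conv_lhs => rw [h2]
    rw [ν.map_update_sum_smul (fun j => T' (b j)), mul_comm]
  have hne : b.det B ≠ 0 := right_ne_zero_of_mul_eq_one hone
  have hc : ν (fun j => T' (b j)) = (b.det B)⁻¹ := eq_inv_of_mul_eq_one_left hone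
  simp only [hi, hc, mul_smul]
  rw [← Finset.smul_sum, b.sum_repr]

end Alternating

/-! ### Volume estimates from Hadamard's inequality. -/

section Hadamard

variable {m : ℕ} {W : Type*} [NormedAddCommGroup W] [InnerProductSpace ℝ W]

/-- Hadamard's inequality. -/
theorem AlternatingMap.abs_apply_le_prod_norm (hm : Module.finrank ℝ W = m + 1)
    (ν : W [⋀^Fin (m + 1)]→ₗ[ℝ] ℝ)
    (hν : ∀ v : Fin (m + 1) → W, Orthonormal ℝ v → ν v = 1 ∨ ν v = -1) (v : Fin (m + 1) → W) :
    |ν v| ≤ ∏ i, ‖v i‖ := by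
  have : Fact (Module.finrank ℝ W = m + 1) := ⟨hm⟩
  have : FiniteDimensional ℝ W := .of_fact_finrank_eq_succ m
  let b : OrthonormalBasis (Fin (m + 1)) ℝ W := (stdOrthonormalBasis ℝ W).reindex (finCongr hm)
  have h := b.toBasis.orientation.abs_volumeForm_apply_le v
  rw [b.toBasis.orientation.volumeForm_robust b rfl] at h
  have h1 : ν v = ν b * b.toBasis.det v := by
    conv_lhs => rw [ν.eq_smul_basis_det b.toBasis]
    simp
  rw [h1, abs_mul]
  rcases hν b b.orthonormal with h2 | h2 <;> simpa [h2] using h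

/-- Putting the sum into slot `j` multiplies `ν v` by `a j`; Hadamard's inequality bounds the new
value, the `m` other vectors contributing `R ^ m`. This is a quantitative injectivity statement,
used for `φ` with the factor λ and, on a coordinate hyperplane, with a cofactor that does not
vanish. -/
theorem AlternatingMap.abs_coeff_mul_abs_le (hm : Module.finrank ℝ W = m + 1)
    (ν : W [⋀^Fin (m + 1)]→ₗ[ℝ] ℝ)
    (hν : ∀ v : Fin (m + 1) → W, Orthonormal ℝ v → ν v = 1 ∨ ν v = -1) (v : Fin (m + 1) → W)
    {R : ℝ} (hR : ∀ i, ‖v i‖ ≤ R) (a : Fin (m + 1) → ℝ) (j : Fin (m + 1)) :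
    |a j| * |ν v| ≤ R ^ m * ‖∑ l, a l • v l‖ := by
  classical
  rw [← abs_mul, ← ν.map_update_sum_smul v a j]
  refine (ν.abs_apply_le_prod_norm hm hν _).trans ?_
  rw [← Finset.mul_prod_erase _ _ (Finset.mem_univ j), Function.update_self, mul_comm]
  gcongr
  calc _ = ∏ l ∈ Finset.univ.erase j, ‖v l‖ := Finset.prod_congr rfl fun l hl => by
        rw [Function.update_of_ne (Finset.ne_of_mem_erase hl)]
    _ ≤ ∏ l ∈ Finset.univ.erase j, R := Finset.prod_le_prod (fun _ _ => norm_nonneg _)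
        fun l _ => hR l
    _ = R ^ m := by simp

/-- An alternating form that is `±1` on orthonormal frames vanishes exactly on the families that
are not bases. -/
theorem AlternatingMap.apply_ne_zero_iff_bijective {X : Type*} [AddCommGroup X] [Module ℝ X]
    (hm : Module.finrank ℝ W = m + 1) (ν : W [⋀^Fin (m + 1)]→ₗ[ℝ] ℝ)
    (hν : ∀ v : Fin (m + 1) → W, Orthonormal ℝ v → ν v = 1 ∨ ν v = -1)
    (b : Module.Basis (Fin (m + 1)) ℝ X) (T : X →ₗ[ℝ] W) :
    ν (fun j => T (b j)) ≠ 0 ↔ Function.Bijective T := by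
  have : Fact (Module.finrank ℝ W = m + 1) := ⟨hm⟩
  have : FiniteDimensional ℝ W := .of_fact_finrank_eq_succ m
  have : FiniteDimensional ℝ X := b.finiteDimensional_of_finite
  have hX : Module.finrank ℝ X = m + 1 := by simp [Module.finrank_eq_card_basis b]
  have hν0 : ν ≠ 0 := by
    let e : OrthonormalBasis (Fin (m + 1)) ℝ W :=
      (stdOrthonormalBasis ℝ W).reindex (finCongr hm)
    rintro rfl
    rcases hν e e.orthonormal with h | h <;> simp at h
  constructor
  · intro h
    have hli : LinearIndependent ℝ (fun j => T (b j)) := by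
      by_contra hli
      exact h (ν.map_linearDependent _ hli)
    have hinj : Function.Injective T := by
      rw [← LinearMap.ker_eq_bot, LinearMap.ker_eq_bot']
      intro x hx
      rw [← b.sum_repr x, map_sum] at hx
      simp only [map_smul] at hx
      have h0 := Fintype.linearIndependent_iff.1 hli _ hx
      apply b.repr.injective
      ext j
      simpa using h0 j
    exact ⟨hinj, (LinearMap.injective_iff_surjective_of_finrank_eq_finrank (hX.trans hm.symm)).1
      hinj⟩
  · intro h
    let e := LinearEquiv.ofBijective T h
    have hmap : ⇑(b.map e) = fun j => T (b j) := by
      funext j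
      simp [e]
    exact hmap ▸ (ν.map_basis_ne_zero_iff (b.map e)).2 hν0

end Hadamard

/-! ### Smooth fields, cofactor fields and division by the Jacobian. -/

namespace FrontBundles

noncomputable section

variable {k : ℕ} {M : Type*} [TopologicalSpace M]
  [ChartedSpace (EuclideanSpace ℝ (Fin (k + 1))) M]
  [IsManifold (𝓡 (k + 1)) ∞ M]
  {F : Type*} [NormedAddCommGroup F] [NormedSpace ℝ F] [FiniteDimensional ℝ F]
  {V : M → Type*} [TopologicalSpace (TotalSpace F V)]
  [∀ x, NormedAddCommGroup (V x)] [∀ x, InnerProductSpace ℝ (V x)]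
  [FiberBundle F V] [VectorBundle ℝ F V]
  [ContMDiffVectorBundle ∞ F V (𝓡 (k + 1))]
  [IsContMDiffRiemannianBundle (𝓡 (k + 1)) ∞ F V]
  {o : ∀ x : M, Orientation ℝ (TangentSpace (𝓡 (k + 1)) x) (Fin (k + 1))}
  {μ : ∀ x : M, V x [⋀^Fin (k + 1)]→ₗ[ℝ] ℝ}
  {D : CovariantDerivative (𝓡 (k + 1)) F V}
  {φ ψ : ∀ x : M, TangentSpace (𝓡 (k + 1)) x →L[ℝ] V x}
  {e : OpenPartialHomeomorph M (EuclideanSpace ℝ (Fin (k + 1)))} {p : M}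

set_option linter.unusedSectionVars false

/-- The vector field `X` is smooth at `p`. -/
abbrev SmoothFieldAt (X : ∀ x : M, TangentSpace (𝓡 (k + 1)) x) (p : M) : Prop :=
  ContMDiffAt (𝓡 (k + 1)) ((𝓡 (k + 1)).prod 𝓘(ℝ, EuclideanSpace ℝ (Fin (k + 1)))) ∞
    (fun y => TotalSpace.mk' (EuclideanSpace ℝ (Fin (k + 1))) y (X y)) p

/-- The section `s` is smooth at `p`. -/
abbrev SmoothSectionAt (k : ℕ) {M : Type*} [TopologicalSpace M]
    [ChartedSpace (EuclideanSpace ℝ (Fin (k + 1))) M] (F : Type*) [NormedAddCommGroup F] [NormedSpace ℝ F]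
    {V : M → Type*} [TopologicalSpace (TotalSpace F V)]
    [∀ x, NormedAddCommGroup (V x)] [∀ x, InnerProductSpace ℝ (V x)] [FiberBundle F V]
    (s : ∀ x : M, V x) (p : M) : Prop :=
  ContMDiffAt (𝓡 (k + 1)) ((𝓡 (k + 1)).prod 𝓘(ℝ, F)) ∞ (fun y => TotalSpace.mk' F y (s y)) p

/-- The real function `f` is smooth at `p`. -/
abbrev SmoothFunAt (k : ℕ) {M : Type*} [TopologicalSpace M]
    [ChartedSpace (EuclideanSpace ℝ (Fin (k + 1))) M] (f : M → ℝ) (p : M) : Prop :=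
  ContMDiffAt (𝓡 (k + 1)) 𝓘(ℝ, ℝ) ∞ f p

theorem IsPositiveChart.exists_basis (he : IsPositiveChart o e) {x : M} (hx : x ∈ e.source) :
    ∃ b : Module.Basis (Fin (k + 1)) ℝ (TangentSpace (𝓡 (k + 1)) x),
      (∀ j, b j = coordVec e j x) ∧ b.orientation = o x := by
  obtain ⟨b, hb, hbo⟩ := he.2 x hx
  exact ⟨b, fun j => congrFun hb j, hbo⟩

theorem IsPositiveChart.smoothFieldAt_coordVec (he : IsPositiveChart o e)
    (hp : p ∈ e.source) (j : Fin (k + 1)) : SmoothFieldAt (coordVec e j) p := by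
  obtain ⟨b, hb, -⟩ := he.exists_basis hp
  -- The inverse of a non-invertible map is 0 by convention, so a nonzero coordinate vector forces
  -- invertibility.
  have hinv : (mfderiv (𝓡 (k + 1)) (𝓡 (k + 1)) e p).IsInvertible := by
    by_contra h
    apply b.ne_zero j
    rw [hb, coordVec]
    change (mfderiv (𝓡 (k + 1)) (𝓡 (k + 1)) e p).inverse _ = 0
    rw [ContinuousLinearMap.inverse_of_not_isInvertible h]
    rfl
  let W : ∀ y : EuclideanSpace ℝ (Fin (k + 1)), TangentSpace (𝓡 (k + 1)) y :=
    fun _ => EuclideanSpace.single j (1 : ℝ)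
  have hV : ContMDiffAt (𝓡 (k + 1)) (𝓡 (k + 1)).tangent ∞
      (fun y => (⟨y, W y⟩ : TangentBundle (𝓡 (k + 1)) (EuclideanSpace ℝ (Fin (k + 1)))))
      (e p) :=
    contMDiffAt_vectorSpace_iff_contDiffAt.2 contDiffAt_const
  have : IsManifold (𝓡 (k + 1)) 1 M := .of_le (n := ∞) (by simp)
  exact hV.mpullback_vectorField_preimage (contMDiffAt_of_mem_maximalAtlas he.1 hp) hinv
    (by simp)

theorem finrank_fiber (h : Module.finrank ℝ F = k + 1) (x : M) :
    Module.finrank ℝ (V x) = k + 1 := by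
  rw [← h]
  exact ((trivializationAt F V x).continuousLinearEquivAt ℝ x
    (mem_baseSet_trivializationAt F V x)).toLinearEquiv.finrank_eq

theorem IsCoherentTangentBundle.smoothSectionAt_apply (h : IsCoherentTangentBundle D φ)
    {X : ∀ x : M, TangentSpace (𝓡 (k + 1)) x} (hX : SmoothFieldAt X p) :
    SmoothSectionAt k F (fun x => φ x (X x)) p :=
  ContMDiffAt.clm_bundle_apply (h.smooth_hom p) hX

theorem smoothFunAt_inner {s t : ∀ x : M, V x} (hs : SmoothSectionAt k F s p)
    (ht : SmoothSectionAt k F t p) : SmoothFunAt k (fun x => inner ℝ (s x) (t x)) p :=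
  ContMDiffAt.inner_bundle hs ht

theorem smoothFunAt_jacobian (hφ : IsCoherentTangentBundle D φ) (hμ : IsCoorientation F μ)
    (he : IsPositiveChart o e) (hp : p ∈ e.source) : SmoothFunAt k (jacobian μ φ e) p :=
  hμ.smooth _ p fun j => hφ.smoothSectionAt_apply (he.smoothFieldAt_coordVec hp j)

/-- The components of the cofactor field of `φ` associated with a section `n`. -/
def cofactor (μ : ∀ x : M, V x [⋀^Fin (k + 1)]→ₗ[ℝ] ℝ)
    (φ : ∀ x : M, TangentSpace (𝓡 (k + 1)) x →L[ℝ] V x)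
    (e : OpenPartialHomeomorph M (EuclideanSpace ℝ (Fin (k + 1)))) (n : ∀ x : M, V x)
    (i : Fin (k + 1)) (x : M) : ℝ :=
  μ x (Function.update (fun j => φ x (coordVec e j x)) i (n x))

/-- The vector field which `φ` maps to the multiple `λ_φ n` of a section `n`. -/
def cofactorField (μ : ∀ x : M, V x [⋀^Fin (k + 1)]→ₗ[ℝ] ℝ)
    (φ : ∀ x : M, TangentSpace (𝓡 (k + 1)) x →L[ℝ] V x)
    (e : OpenPartialHomeomorph M (EuclideanSpace ℝ (Fin (k + 1)))) (n : ∀ x : M, V x)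
    (x : M) : TangentSpace (𝓡 (k + 1)) x :=
  ∑ i, cofactor μ φ e n i x • coordVec e i x

theorem smoothFunAt_cofactor (hφ : IsCoherentTangentBundle D φ) (hμ : IsCoorientation F μ)
    (he : IsPositiveChart o e) (hp : p ∈ e.source) {n : ∀ x : M, V x}
    (hn : SmoothSectionAt k F n p) (i : Fin (k + 1)) : SmoothFunAt k (cofactor μ φ e n i) p := by
  have h := hμ.smooth (Function.update (fun j x => φ x (coordVec e j x)) i n) p fun j => by
    by_cases hj : j = i
    · subst hj
      simpa using hn
    · simpa [hj] using hφ.smoothSectionAt_apply (he.smoothFieldAt_coordVec hp j)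
  convert h using 2 with x
  rw [cofactor]
  congr 1
  funext j
  by_cases hj : j = i
  · subst hj; simp
  · simp [hj]

theorem SmoothFieldAt.sum_smul {ι : Type*} [Fintype ι] {f : ι → M → ℝ}
    {X : ι → ∀ x : M, TangentSpace (𝓡 (k + 1)) x} (hf : ∀ i, SmoothFunAt k (f i) p)
    (hX : ∀ i, SmoothFieldAt (X i) p) : SmoothFieldAt (fun x => ∑ i, f i x • X i x) p :=
  ContMDiffAt.sum_section (fun i _ => (hf i).smul_section (hX i))

theorem smoothFieldAt_cofactorField (hφ : IsCoherentTangentBundle D φ) (hμ : IsCoorientation F μ)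
    (he : IsPositiveChart o e) (hp : p ∈ e.source) {n : ∀ x : M, V x}
    (hn : SmoothSectionAt k F n p) : SmoothFieldAt (cofactorField μ φ e n) p :=
  SmoothFieldAt.sum_smul (fun i => smoothFunAt_cofactor hφ hμ he hp hn i)
    fun i => he.smoothFieldAt_coordVec hp i

theorem exists_smoothFieldAt_eq (X₀ : TangentSpace (𝓡 (k + 1)) p) :
    ∃ X : ∀ x : M, TangentSpace (𝓡 (k + 1)) x, SmoothFieldAt X p ∧ X p = X₀ :=
  ⟨FiberBundle.extend (EuclideanSpace ℝ (Fin (k + 1))) X₀,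
    FiberBundle.contMDiffAt_extend (k := ∞) (𝓡 (k + 1)) _ X₀, by simp⟩

theorem exists_smoothSectionAt_eq (v : V p) :
    ∃ s : ∀ x : M, V x, SmoothSectionAt k F s p ∧ s p = v :=
  ⟨FiberBundle.extend F v, FiberBundle.contMDiffAt_extend (k := ∞) (𝓡 (k + 1)) F v, by simp⟩

theorem map_cofactorField (h : Module.finrank ℝ F = k + 1) (n : ∀ x : M, V x) (x : M) :
    φ x (cofactorField μ φ e n x) = jacobian μ φ e x • n x := by
  have hV := finrank_fiber (V := V) h x
  have : FiniteDimensional ℝ (V x) := .of_finrank_pos (by omega)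
  let b : Module.Basis (Fin (k + 1)) ℝ (V x) := (Module.finBasisOfFinrankEq ℝ (V x) hV)
  have := (μ x).sum_map_update_smul b (fun j => φ x (coordVec e j x)) (n x)
  rw [cofactorField, map_sum]
  simp only [map_smul]
  exact this

theorem IsPositiveChart.mem_singularSet_iff (h : Module.finrank ℝ F = k + 1)
    (hμ : IsCoorientation F μ) (he : IsPositiveChart o e) {x : M} (hx : x ∈ e.source) :
    x ∈ singularSet φ ↔ jacobian μ φ e x = 0 := by
  obtain ⟨b, hb, -⟩ := he.exists_basis hx
  have := (μ x).apply_ne_zero_iff_bijective (finrank_fiber h x) (hμ.unit x) b (φ x).toLinearMap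
  rw [singularSet, mem_ofPred_eq, not_iff_comm, ← ne_eq]
  simpa [jacobian, hb] using this

/-- The homomorphism `φ` maps the field `η` to a multiple `lam n`, where `lam` defines the
singular set near `p`. -/
structure IsNullDivision (F : Type*) [NormedAddCommGroup F] [NormedSpace ℝ F]
    {V : M → Type*} [TopologicalSpace (TotalSpace F V)]
    [∀ x, NormedAddCommGroup (V x)] [∀ x, InnerProductSpace ℝ (V x)] [FiberBundle F V]
    (φ : ∀ x : M, TangentSpace (𝓡 (k + 1)) x →L[ℝ] V x) (p : M)
    (lam : M → ℝ) (n : ∀ x : M, V x) (η : ∀ x : M, TangentSpace (𝓡 (k + 1)) x) : Prop where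
  smooth_lam : SmoothFunAt k lam p
  smooth_section : SmoothSectionAt k F n p
  smooth_field : SmoothFieldAt η p
  singular : ∀ᶠ q in 𝓝 p, q ∈ singularSet φ ↔ lam q = 0
  map_field : ∀ᶠ q in 𝓝 p, φ q (η q) = lam q • n q

theorem IsPositiveChart.isNullDivision (hφ : IsCoherentTangentBundle D φ)
    (hμ : IsCoorientation F μ) (he : IsPositiveChart o e) (hp : p ∈ e.source)
    {n : ∀ x : M, V x} (hn : SmoothSectionAt k F n p) :
    IsNullDivision F φ p (jacobian μ φ e) n (cofactorField μ φ e n) where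
  smooth_lam := smoothFunAt_jacobian hφ hμ he hp
  smooth_section := hn
  smooth_field := smoothFieldAt_cofactorField hφ hμ he hp hn
  singular := by
    filter_upwards [e.open_source.mem_nhds hp] with q hq
    exact he.mem_singularSet_iff hφ.rank_eq hμ hq
  map_field := .of_forall fun q => map_cofactorField hφ.rank_eq n q

theorem SmoothFunAt.mdifferentiableAt {f : M → ℝ} (hf : SmoothFunAt k f p) :
    MDifferentiableAt (𝓡 (k + 1)) 𝓘(ℝ, ℝ) f p :=
  ContMDiffAt.mdifferentiableAt hf (by simp)

theorem SmoothFunAt.eventually_continuousAt {f : M → ℝ} (hf : SmoothFunAt k f p) :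
    ∀ᶠ q in 𝓝 p, ContinuousAt f q := by
  have h1 : ContMDiffAt (𝓡 (k + 1)) 𝓘(ℝ, ℝ) 1 f p := hf.of_le (by simp)
  have : IsManifold (𝓡 (k + 1)) 1 M := .of_le (n := ∞) (by simp)
  filter_upwards [(contMDiffAt_iff_contMDiffAt_nhds (by simp)).1 h1] with q hq
  exact hq.continuousAt

/-- If `h F ≥ 0` near a regular point of `h`, then `F` vanishes on the zero set of `h`. -/
theorem SmoothFunAt.eventually_eq_zero_of_mul_nonneg {h G : M → ℝ} (hh : SmoothFunAt k h p)
    (hG : SmoothFunAt k G p) (hdh : mvfderiv (𝓡 (k + 1)) h p ≠ 0)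
    (hpos : ∀ᶠ q in 𝓝 p, h q ≠ 0 → 0 ≤ h q * G q) : ∀ᶠ q in 𝓝 p, h q = 0 → G q = 0 := by
  filter_upwards [ContMDiffAt.eventually_frequently_pos_neg hh (by simp) hdh,
    hG.eventually_continuousAt, eventually_eventually_nhds.2 hpos] with q hq hc hpos hq0
  obtain ⟨h1, h2⟩ := hq hq0
  by_contra hne
  -- The sign of `G` persists near `q`, while `h` takes the opposite sign arbitrarily close to `q`.
  rcases lt_or_gt_of_ne hne with hlt | hgt
  · obtain ⟨y, hy, hG, hp⟩ := (h1.and_eventually ((hc.eventually_lt_const hlt).and hpos)).exists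
    nlinarith [hp hy.ne']
  · obtain ⟨y, hy, hG, hp⟩ := (h2.and_eventually ((hc.eventually_const_lt hgt).and hpos)).exists
    nlinarith [hp hy.ne]

theorem SmoothFieldAt.mdifferentiableAt {X : ∀ x : M, TangentSpace (𝓡 (k + 1)) x}
    (hX : SmoothFieldAt X p) :
    MDifferentiableAt (𝓡 (k + 1)) ((𝓡 (k + 1)).prod 𝓘(ℝ, EuclideanSpace ℝ (Fin (k + 1))))
      (fun y => TotalSpace.mk' (EuclideanSpace ℝ (Fin (k + 1))) y (X y)) p :=
  ContMDiffAt.mdifferentiableAt hX (by simp)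

theorem SmoothSectionAt.mdifferentiableAt {s : ∀ x : M, V x} (hs : SmoothSectionAt k F s p) :
    MDifferentiableAt (𝓡 (k + 1)) ((𝓡 (k + 1)).prod 𝓘(ℝ, F))
      (fun y => TotalSpace.mk' F y (s y)) p :=
  ContMDiffAt.mdifferentiableAt hs (by simp)

theorem IsCoherentTangentBundle.mvfderiv_inner (h : IsCoherentTangentBundle D φ)
    {s t : ∀ x : M, V x} (hs : SmoothSectionAt k F s p) (ht : SmoothSectionAt k F t p)
    (v : TangentSpace (𝓡 (k + 1)) p) :
    mvfderiv (𝓡 (k + 1)) (fun x => inner ℝ (s x) (t x)) p v =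
      inner ℝ (D s p v) (t p) + inner ℝ (s p) (D t p v) := by
  obtain ⟨X, -, rfl⟩ := exists_smoothFieldAt_eq v
  exact h.metric.mvfderiv_inner_eq X hs.mdifferentiableAt ht.mdifferentiableAt

/-- The bracket enters only through a vector in the image of `φ`. In most applications that term
disappears on pairing with a vector orthogonal to the image, so it need not be computed. -/
theorem IsCoherentTangentBundle.exists_connection_swap (h : IsCoherentTangentBundle D φ)
    {X Y : ∀ x : M, TangentSpace (𝓡 (k + 1)) x} (hX : SmoothFieldAt X p)
    (hY : SmoothFieldAt Y p) :
    ∃ z, D (fun y => φ y (X y)) p (Y p) = D (fun y => φ y (Y y)) p (X p) + φ p z := by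
  refine ⟨-VectorField.mlieBracket (𝓡 (k + 1)) X Y p, ?_⟩
  have := h.coherent p X Y hX.mdifferentiableAt hY.mdifferentiableAt
  rw [map_neg, ← sub_eq_add_neg]
  rw [sub_sub, sub_eq_zero] at this
  rw [this]
  abel

namespace IsNullDivision

variable {lam : M → ℝ} {n : ∀ x : M, V x} {η : ∀ x : M, TangentSpace (𝓡 (k + 1)) x}

theorem lam_eq_zero (h : IsNullDivision F φ p lam n η) (hp : p ∈ singularSet φ) : lam p = 0 :=
  h.singular.self_of_nhds.1 hp

theorem map_field_eq_zero (h : IsNullDivision F φ p lam n η) (hp : p ∈ singularSet φ) :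
    φ p (η p) = 0 := by
  rw [h.map_field.self_of_nhds, h.lam_eq_zero hp, zero_smul]

/-- Leibniz rule for λn; the term λ Dn drops out at a zero of λ. -/
theorem connection_map_field (h : IsNullDivision F φ p lam n η)
    (hφ : IsCoherentTangentBundle D φ) (hp : p ∈ singularSet φ)
    (v : TangentSpace (𝓡 (k + 1)) p) :
    D (fun y => φ y (η y)) p v = mvfderiv (𝓡 (k + 1)) lam p v • n p := by
  have h1 : SmoothSectionAt k F (lam • n) p := h.smooth_lam.smul_section h.smooth_section
  have h2 := D.isCovariantDerivativeOn (s := univ) |>.congr_of_eventuallyEq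
    (hφ.smoothSectionAt_apply h.smooth_field).mdifferentiableAt h1.mdifferentiableAt univ_mem
    h.map_field
  rw [h2, D.isCovariantDerivativeOn.leibniz h.smooth_section.mdifferentiableAt
    h.smooth_lam.mdifferentiableAt, h.lam_eq_zero hp]
  simp

/-- The null field does not vanish where `n` is transversal to the image of `φ`. -/
theorem field_ne_zero (h : IsNullDivision F φ p lam n η) (hφ : IsCoherentTangentBundle D φ)
    (hp : p ∈ singularSet φ) (hd : mvfderiv (𝓡 (k + 1)) lam p ≠ 0)
    (hn : ∀ z, φ p z ≠ n p) : η p ≠ 0 := by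
  intro h0
  obtain ⟨w, hw⟩ : ∃ w, mvfderiv (𝓡 (k + 1)) lam p w ≠ 0 := by
    by_contra! H
    exact hd (ContinuousLinearMap.ext H)
  -- If η vanished at `p`, swapping the roles of η and X would leave dλ(X) n in the image of `φ`,
  -- although dλ(X) ≠ 0.
  obtain ⟨X, hX, rfl⟩ := exists_smoothFieldAt_eq w
  obtain ⟨z, hz⟩ := hφ.exists_connection_swap h.smooth_field hX
  rw [h.connection_map_field hφ hp, h0, map_zero, zero_add] at hz
  apply hn ((mvfderiv (𝓡 (k + 1)) lam p (X p))⁻¹ • z)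
  rw [map_smul, ← hz, smul_smul, inv_mul_cancel₀ hw, one_smul]

end IsNullDivision

/-! ### Numerator and denominator of the extrinsic curvature. -/

section Curvature

/-- The numerator of the extrinsic curvature. -/
def extNum (φ ψ : ∀ x : M, TangentSpace (𝓡 (k + 1)) x →L[ℝ] V x) (x : M)
    (X Y : TangentSpace (𝓡 (k + 1)) x) : ℝ :=
  formII φ ψ x X X * formII φ ψ x Y Y - formII φ ψ x X Y ^ 2

/-- The denominator of the extrinsic curvature. -/
def extDen (φ : ∀ x : M, TangentSpace (𝓡 (k + 1)) x →L[ℝ] V x) (x : M)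
    (X Y : TangentSpace (𝓡 (k + 1)) x) : ℝ :=
  formI φ x X X * formI φ x Y Y - formI φ x X Y ^ 2

/-- Gram–Schmidt without division: it exhibits the Gram determinant as a squared length, which gives
positivity here and a lower bound in `sq_le_extDen_mul`. -/
theorem norm_sq_smul_sub_inner_smul {W : Type*} [NormedAddCommGroup W] [InnerProductSpace ℝ W]
    (u w : W) : ‖inner ℝ u u • w - inner ℝ u w • u‖ ^ 2
      = inner ℝ u u * (inner ℝ u u * inner ℝ w w - inner ℝ u w ^ 2) := by
  rw [← real_inner_self_eq_norm_sq]
  simp only [inner_sub_left, inner_sub_right, real_inner_smul_left, real_inner_smul_right,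
    real_inner_comm u w]
  ring

theorem extDen_pos {x : M} (hinj : Function.Injective (φ x)) {X Y : TangentSpace (𝓡 (k + 1)) x}
    (h : LinearIndependent ℝ ![X, Y]) : 0 < extDen φ x X Y := by
  rw [LinearIndependent.pair_iff] at h
  have hX : φ x X ≠ 0 := fun h0 => by
    have hX0 : X = 0 := hinj (by rw [h0, map_zero])
    simpa using (h 1 0 (by simp [hX0])).1
  have huu : 0 < inner ℝ (φ x X) (φ x X) := real_inner_self_pos.2 hX
  have hne : inner ℝ (φ x X) (φ x X) • φ x Y - inner ℝ (φ x X) (φ x Y) • φ x X ≠ 0 := by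
    intro h0
    rw [← map_smul, ← map_smul, ← map_sub] at h0
    have h1 : inner ℝ (φ x X) (φ x X) • Y - inner ℝ (φ x X) (φ x Y) • X = 0 :=
      hinj (by rw [h0, map_zero])
    have := h (-inner ℝ (φ x X) (φ x Y)) (inner ℝ (φ x X) (φ x X)) (by rw [← h1]; module)
    exact huu.ne' this.2
  have := norm_sq_smul_sub_inner_smul (φ x X) (φ x Y)
  have hpos : 0 < inner ℝ (φ x X) (φ x X) * extDen φ x X Y := by
    rw [extDen, formI, formI, formI, ← this]
    positivity
  exact pos_of_mul_pos_right hpos huu.le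

/-- With denominators cleared, curvature bounds hold trivially for dependent pairs, so no
independence has to be tracked for fields evaluated at varying points. -/
theorem extNum_eq_zero_and_extDen_eq_zero {x : M} {X Y : TangentSpace (𝓡 (k + 1)) x}
    (h : ¬ LinearIndependent ℝ ![X, Y]) : extNum φ ψ x X Y = 0 ∧ extDen φ x X Y = 0 := by
  rw [LinearIndependent.pair_iff] at h
  push Not at h
  obtain ⟨s, t, hst, hne⟩ := h
  by_cases hs : s = 0
  · have ht := hne hs
    have hY : Y = 0 := by
      rw [hs, zero_smul, zero_add] at hst
      exact (smul_eq_zero.1 hst).resolve_left ht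
    simp [extNum, extDen, formI, formII, hY]
  · have hX : X = (-(t / s)) • Y := by
      have h1 : s • X = -(t • Y) := eq_neg_of_add_eq_zero_left hst
      calc X = s⁻¹ • (s • X) := by rw [smul_smul, inv_mul_cancel₀ hs, one_smul]
        _ = _ := by rw [h1]; module
    rw [hX]
    simp only [extNum, extDen, formI, formII, map_smul, real_inner_smul_left,
      real_inner_smul_right]
    constructor <;> ring

theorem extDen_nonneg {x : M} (X Y : TangentSpace (𝓡 (k + 1)) x) : 0 ≤ extDen φ x X Y := by
  rw [extDen, sub_nonneg, sq]
  exact real_inner_mul_inner_self_le (φ x X) (φ x Y)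

theorem mul_extDen_le_extNum {x : M} (hinj : Function.Injective (φ x)) {δ : ℝ}
    {X Y : TangentSpace (𝓡 (k + 1)) x}
    (h : LinearIndependent ℝ ![X, Y] → δ ≤ extCurv φ ψ x X Y) :
    δ * extDen φ x X Y ≤ extNum φ ψ x X Y := by
  by_cases hli : LinearIndependent ℝ ![X, Y]
  · exact (le_div_iff₀ (extDen_pos hinj hli)).1 (h hli)
  · have h0 := extNum_eq_zero_and_extDen_eq_zero (φ := φ) (ψ := ψ) hli
    rw [h0.1, h0.2, mul_zero]

theorem extNum_le_mul_extDen {x : M} (hinj : Function.Injective (φ x)) {δ : ℝ}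
    {X Y : TangentSpace (𝓡 (k + 1)) x}
    (h : LinearIndependent ℝ ![X, Y] → extCurv φ ψ x X Y ≤ δ) :
    extNum φ ψ x X Y ≤ δ * extDen φ x X Y := by
  by_cases hli : LinearIndependent ℝ ![X, Y]
  · exact (div_le_iff₀ (extDen_pos hinj hli)).1 (h hli)
  · have h0 := extNum_eq_zero_and_extDen_eq_zero (φ := φ) (ψ := ψ) hli
    rw [h0.1, h0.2, mul_zero]

theorem injective_of_notMem_singularSet {x : M} (hx : x ∉ singularSet φ) :
    Function.Injective (φ x) :=
  (not_not.1 hx).1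

end Curvature

/-! ### Vanishing of the second fundamental form from bounds or a sign of the curvature. -/

namespace IsFrontBundle

theorem extNum_eq (h : IsFrontBundle D φ ψ) {x : M} (X Y : TangentSpace (𝓡 (k + 1)) x) :
    extNum φ ψ x X Y = inner ℝ (φ x X) (ψ x X) * inner ℝ (φ x Y) (ψ x Y)
      - inner ℝ (φ x Y) (ψ x X) ^ 2 := by
  rw [extNum, formII, formII, formII, h.compatible x X Y]
  ring

theorem inner_eq_zero_of_diag (h : IsFrontBundle D φ ψ) {x : M}
    (hd : ∀ X, inner ℝ (φ x X) (ψ x X) = 0) (X Y : TangentSpace (𝓡 (k + 1)) x) :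
    inner ℝ (φ x X) (ψ x Y) = 0 := by
  have := hd (X + Y)
  simp only [map_add, inner_add_left, inner_add_right, hd, h.compatible x Y X] at this
  linarith

theorem smoothFunAt_inner_apply (h : IsFrontBundle D φ ψ)
    {X Y : ∀ x : M, TangentSpace (𝓡 (k + 1)) x} (hX : SmoothFieldAt X p)
    (hY : SmoothFieldAt Y p) : SmoothFunAt k (fun x => inner ℝ (φ x (X x)) (ψ x (Y x))) p :=
  smoothFunAt_inner (h.coherent_fst.smoothSectionAt_apply hX)
    (h.coherent_snd.smoothSectionAt_apply hY)

variable {lam : M → ℝ} {n : ∀ x : M, V x} {η : ∀ x : M, TangentSpace (𝓡 (k + 1)) x}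

/-- With `l` = λ only one factor λ splits off, against two in `extDen_null`: this is the possible
pole of the curvature. -/
theorem extNum_null (h : IsFrontBundle D φ ψ) {x : M} {X Z : TangentSpace (𝓡 (k + 1)) x}
    {l : ℝ} {v : V x} (hZ : φ x Z = l • v) :
    extNum φ ψ x X Z = l * (inner ℝ (φ x X) (ψ x X) * inner ℝ v (ψ x Z)
      - l * inner ℝ v (ψ x X) ^ 2) := by
  rw [h.extNum_eq, hZ, real_inner_smul_left, real_inner_smul_left]
  ring

theorem _root_.FrontBundles.extDen_null {x : M} {X Z : TangentSpace (𝓡 (k + 1)) x}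
    {l : ℝ} {v : V x} (hZ : φ x Z = l • v) :
    extDen φ x X Z = l ^ 2 * (inner ℝ (φ x X) (φ x X) * inner ℝ v v
      - inner ℝ (φ x X) v ^ 2) := by
  simp only [extDen, formI, hZ, real_inner_smul_left, real_inner_smul_right]
  ring

/-- Boundedness of the extrinsic curvature forces the second fundamental form to vanish. -/
theorem formII_eq_zero_of_bounded (h : IsFrontBundle D φ ψ)
    (hd : IsNullDivision F φ p lam n η) (hp : p ∈ singularSet φ)
    (hdl : mvfderiv (𝓡 (k + 1)) lam p ≠ 0) (hρ : inner ℝ (n p) (ψ p (η p)) ≠ 0)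
    {U : Set M} (hU : U ∈ 𝓝 p) {C : ℝ} (hC : ExtCurvOn φ ψ U (fun c => |c| ≤ C))
    (X Y : TangentSpace (𝓡 (k + 1)) p) : formII φ ψ p X Y = 0 := by
  rw [formII, neg_eq_zero]
  refine h.inner_eq_zero_of_diag (fun X₀ => ?_) X Y
  obtain ⟨X, hX, rfl⟩ := exists_smoothFieldAt_eq X₀
  have hφX := h.coherent_fst.smoothSectionAt_apply hX
  have hψX := h.coherent_snd.smoothSectionAt_apply hX
  have hψη := h.coherent_snd.smoothSectionAt_apply hd.smooth_field
  set f : M → ℝ := fun x => inner ℝ (φ x (X x)) (ψ x (X x))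
  set ρ : M → ℝ := fun x => inner ℝ (n x) (ψ x (η x))
  set g : M → ℝ := fun x => inner ℝ (n x) (ψ x (X x))
  set d : M → ℝ := fun x => inner ℝ (φ x (X x)) (φ x (X x)) * inner ℝ (n x) (n x)
      - inner ℝ (φ x (X x)) (n x) ^ 2
  have hf : ContinuousAt f p := (smoothFunAt_inner hφX hψX).continuousAt
  have hρc : ContinuousAt ρ p := (smoothFunAt_inner hd.smooth_section hψη).continuousAt
  have hg : ContinuousAt g p := (smoothFunAt_inner hd.smooth_section hψX).continuousAt
  have hdc : ContinuousAt d p :=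
    ((smoothFunAt_inner hφX hφX).continuousAt.mul
      (smoothFunAt_inner hd.smooth_section hd.smooth_section).continuousAt).sub
      ((smoothFunAt_inner hφX hd.smooth_section).continuousAt.pow 2)
  have hl : ContinuousAt lam p := hd.smooth_lam.continuousAt
  have hl0 := hd.lam_eq_zero hp
  have hG : ContinuousAt (fun q => C * (|lam q| * d q) - |f q * ρ q - lam q * g q ^ 2|) p := by
    fun_prop
  have hfreq : ∃ᶠ q in 𝓝 p, 0 < lam q :=
    ((ContMDiffAt.eventually_frequently_pos_neg hd.smooth_lam (by simp) hdl).self_of_nhds hl0).1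
  -- The curvature bound for the plane of X and η, after cancelling one factor λ. By continuity it
  -- survives at `p`, where only −|fρ| remains.
  have hev : ∃ᶠ q in 𝓝 p, 0 ≤ C * (|lam q| * d q) - |f q * ρ q - lam q * g q ^ 2| := by
    refine (hfreq.and_eventually ((hd.singular.and hd.map_field).and hU)).mono ?_
    rintro q ⟨hlq, ⟨hs, hm⟩, hqU⟩
    have hns : q ∉ singularSet φ := fun hq => hlq.ne' (hs.1 hq)
    have hinj := injective_of_notMem_singularSet hns
    have h1 := extNum_le_mul_extDen (φ := φ) (ψ := ψ) hinj (X := X q) (Y := η q)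
      fun hli => (abs_le.1 (hC q ⟨hqU, hns⟩ _ _ hli)).2
    have h2 := mul_extDen_le_extNum (φ := φ) (ψ := ψ) hinj (X := X q) (Y := η q)
      fun hli => (abs_le.1 (hC q ⟨hqU, hns⟩ _ _ hli)).1
    rw [h.extNum_null hm, extDen_null hm] at h1 h2
    have h3 : lam q * (f q * ρ q - lam q * g q ^ 2) ≤ lam q * (C * (lam q * d q)) := by
      calc _ ≤ _ := h1
        _ = _ := by ring
    have h4 : lam q * (-(C * (lam q * d q))) ≤ lam q * (f q * ρ q - lam q * g q ^ 2) := by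
      calc _ = _ := by ring
        _ ≤ _ := h2
    rw [abs_of_pos hlq, sub_nonneg, abs_le]
    exact ⟨le_of_mul_le_mul_left h4 hlq, le_of_mul_le_mul_left h3 hlq⟩
  by_contra hfp
  have hlt : C * (|lam p| * d p) - |f p * ρ p - lam p * g p ^ 2| < 0 := by
    rw [hl0]
    simp only [abs_zero, zero_mul, mul_zero, sub_zero, zero_sub, Left.neg_neg_iff, abs_pos]
    exact mul_ne_zero hfp hρ
  obtain ⟨q, hq1, hq2⟩ := (hev.and_eventually (hG.eventually_lt_const hlt)).exists
  exact absurd hq1 (not_le.2 hq2)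

/-- If the extrinsic curvature does not change sign, the second fundamental form vanishes along
the singular set. -/
theorem eventually_inner_eq_zero_of_sign (h : IsFrontBundle D φ ψ)
    (hd : IsNullDivision F φ p lam n η)
    (hdl : mvfderiv (𝓡 (k + 1)) lam p ≠ 0) (hρ : inner ℝ (n p) (ψ p (η p)) ≠ 0)
    {U : Set M} (hU : U ∈ 𝓝 p)
    (hsign : ExtCurvOn φ ψ U (fun c => 0 ≤ c) ∨ ExtCurvOn φ ψ U (fun c => c ≤ 0))
    {X Y : ∀ x : M, TangentSpace (𝓡 (k + 1)) x} (hX : SmoothFieldAt X p)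
    (hY : SmoothFieldAt Y p) :
    ∀ᶠ q in 𝓝 p, lam q = 0 → inner ℝ (φ q (X q)) (ψ q (Y q)) = 0 := by
  have hρc : ContinuousAt (fun x => inner ℝ (n x) (ψ x (η x))) p :=
    (smoothFunAt_inner hd.smooth_section
      (h.coherent_snd.smoothSectionAt_apply hd.smooth_field)).continuousAt
  have hdiag : ∀ Z : ∀ x : M, TangentSpace (𝓡 (k + 1)) x, SmoothFieldAt Z p →
      ∀ᶠ q in 𝓝 p, lam q = 0 → inner ℝ (φ q (Z q)) (ψ q (Z q)) = 0 := by
    intro Z hZ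
    have hφZ := h.coherent_fst.smoothSectionAt_apply hZ
    have hψZ := h.coherent_snd.smoothSectionAt_apply hZ
    -- The curvature numerator of Z ∧ η is λG, and on λ = 0 the function `G` reduces to ⟨φZ, ψZ⟩ρ.
    set G : M → ℝ := fun x => inner ℝ (φ x (Z x)) (ψ x (Z x)) * inner ℝ (n x) (ψ x (η x))
      - lam x * inner ℝ (n x) (ψ x (Z x)) ^ 2 with hGdef
    have hG : SmoothFunAt k G p :=
      ((smoothFunAt_inner hφZ hψZ).mul (smoothFunAt_inner hd.smooth_section
        (h.coherent_snd.smoothSectionAt_apply hd.smooth_field))).sub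
        (hd.smooth_lam.mul ((smoothFunAt_inner hd.smooth_section hψZ).pow 2))
    have hzero : ∀ᶠ q in 𝓝 p, lam q = 0 → G q = 0 := by
      rcases hsign with hs | hs
      · refine hd.smooth_lam.eventually_eq_zero_of_mul_nonneg hG hdl ?_
        filter_upwards [hd.singular, hd.map_field, hU] with q hsq hm hqU hlq
        have hns : q ∉ singularSet φ := fun hq => hlq (hsq.1 hq)
        have h1 := mul_extDen_le_extNum (φ := φ) (ψ := ψ) (injective_of_notMem_singularSet hns)
          (X := Z q) (Y := η q) fun hli => hs q ⟨hqU, hns⟩ _ _ hli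
        rwa [h.extNum_null hm, zero_mul] at h1
      · have hneg := hd.smooth_lam.eventually_eq_zero_of_mul_nonneg
          (G := fun q => -G q) hG.neg hdl ?_
        · simpa using hneg
        filter_upwards [hd.singular, hd.map_field, hU] with q hsq hm hqU hlq
        have hns : q ∉ singularSet φ := fun hq => hlq (hsq.1 hq)
        have h1 := extNum_le_mul_extDen (φ := φ) (ψ := ψ) (injective_of_notMem_singularSet hns)
          (X := Z q) (Y := η q) fun hli => hs q ⟨hqU, hns⟩ _ _ hli
        rw [h.extNum_null hm, zero_mul] at h1
        rw [mul_neg, neg_nonneg]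
        exact h1
    filter_upwards [hzero, hρc.eventually_ne hρ] with q hq hρq hlq
    have h1 := hq hlq
    simp only [hGdef, hlq, zero_mul, sub_zero] at h1
    exact (mul_eq_zero.1 h1).resolve_right hρq
  filter_upwards [hdiag X hX, hdiag Y hY, hdiag (X + Y) (hX.add_section hY)]
    with q h1 h2 h3 hlq
  have h3 := h3 hlq
  simp only [Pi.add_apply, map_add, inner_add_left, inner_add_right, h1 hlq, h2 hlq,
    h.compatible q (Y q) (X q)] at h3
  linarith

end IsFrontBundle

theorem exists_null_of_mem_singularSet (h : Module.finrank ℝ F = k + 1)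
    (hp : p ∈ singularSet φ) : ∃ Z : TangentSpace (𝓡 (k + 1)) p, Z ≠ 0 ∧ φ p Z = 0 := by
  have hV := finrank_fiber (V := V) h p
  have : FiniteDimensional ℝ (V p) := .of_finrank_pos (by omega)
  have hT : FiniteDimensional ℝ (TangentSpace (𝓡 (k + 1)) p) :=
    inferInstanceAs (FiniteDimensional ℝ (EuclideanSpace ℝ (Fin (k + 1))))
  have hT' : Module.finrank ℝ (TangentSpace (𝓡 (k + 1)) p) = k + 1 := by
    change Module.finrank ℝ (EuclideanSpace ℝ (Fin (k + 1))) = k + 1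
    simp
  by_contra! H
  have hinj : Function.Injective (φ p).toLinearMap := by
    rw [← LinearMap.ker_eq_bot, LinearMap.ker_eq_bot']
    intro Z hZ
    by_contra hne
    exact H Z hne hZ
  exact hp ⟨hinj, (LinearMap.injective_iff_surjective_of_finrank_eq_finrank
    (hT'.trans hV.symm)).1 hinj⟩

/-- Where the cofactor field of `φ` does not vanish, it spans the kernel of `φ`. -/
theorem IsPositiveChart.exists_eq_smul_cofactorField (he : IsPositiveChart o e)
    (hpe : p ∈ e.source) {n : ∀ x : M, V x} (h0 : φ p (cofactorField μ φ e n p) = 0)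
    (hne : cofactorField μ φ e n p ≠ 0) {Z : TangentSpace (𝓡 (k + 1)) p} (hZ : φ p Z = 0) :
    ∃ r : ℝ, Z = r • cofactorField μ φ e n p := by
  obtain ⟨b, hb, -⟩ := he.exists_basis hpe
  obtain ⟨i, hi⟩ : ∃ i, cofactor μ φ e n i p ≠ 0 := by
    by_contra! H
    exact hne (by simp [cofactorField, H])
  have hrepr : ∀ j, b.repr (cofactorField μ φ e n p) j = cofactor μ φ e n j p := fun j => by
    simp only [cofactorField, ← hb]
    exact congrFun (b.repr_sum_self fun i => cofactor μ φ e n i p) j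
  -- A nonzero `i`-th cofactor makes `n` and the `φ(∂_j)`, `j ≠ i`, independent. A null vector
  -- without `i`-th coordinate is therefore zero.
  have hli : LinearIndependent ℝ
      (Function.update (fun j => φ p (coordVec e j p)) i (n p)) := by
    by_contra H
    exact hi ((μ p).map_linearDependent _ H)
  refine ⟨b.repr Z i / cofactor μ φ e n i p, ?_⟩
  set r := b.repr Z i / cofactor μ φ e n i p
  rw [← sub_eq_zero]
  set Y := Z - r • cofactorField μ φ e n p with hY
  have hYi : b.repr Y i = 0 := by
    simp [hY, hrepr, r, hi]
  have hφY : ∑ j, b.repr Y j • Function.update (fun j => φ p (coordVec e j p)) i (n p) j = 0 := by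
    have h1 : φ p Y = ∑ j, b.repr Y j • φ p (coordVec e j p) := by
      conv_lhs => rw [← b.sum_repr Y]
      simp [hb]
    have h2 : φ p Y = 0 := by simp [hY, hZ, h0]
    rw [← h2, h1]
    refine Finset.sum_congr rfl fun j _ => ?_
    by_cases hj : j = i
    · rw [hj, hYi, zero_smul, zero_smul]
    · rw [Function.update_of_ne hj]
  have := Fintype.linearIndependent_iff.1 hli _ hφY
  apply b.repr.injective
  ext j
  simpa using this j

/-- At a nondegenerate singular point there is a section whose null field pairs non-trivially
with it under `ψ`. -/
theorem IsFrontBundle.exists_section_inner_ne_zero (h : IsFrontBundle D φ ψ)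
    (hμ : IsCoorientation F μ) (he : IsPositiveChart o e) (hpe : p ∈ e.source)
    (hp : p ∈ singularSet φ) (hdl : dJacobian μ φ e p ≠ 0) :
    ∃ n : ∀ x : M, V x, SmoothSectionAt k F n p ∧
      inner ℝ (n p) (ψ p (cofactorField μ φ e n p)) ≠ 0 := by
  obtain ⟨Z, hZ0, hZ⟩ := exists_null_of_mem_singularSet h.coherent_fst.rank_eq hp
  have hψZ : ψ p Z ≠ 0 := fun H => hZ0 (h.front p Z hZ H)
  obtain ⟨n, hn, hnp⟩ := exists_smoothSectionAt_eq (k := k) (F := F) (ψ p Z)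
  refine ⟨n, hn, ?_⟩
  have hd := he.isNullDivision h.coherent_fst hμ hpe hn
  have hη0 := hd.map_field_eq_zero hp
  have hne : cofactorField μ φ e n p ≠ 0 := by
    -- By compatibility ψ(Z) is orthogonal to the image of `φ`; if it also lay in the image it would
    -- be orthogonal to itself.
    refine hd.field_ne_zero h.coherent_fst hp hdl fun z hz => hψZ ?_
    rw [hnp] at hz
    have h1 : inner ℝ (φ p z) (ψ p Z) = 0 := by rw [h.compatible, hZ, inner_zero_left]
    rwa [hz, inner_self_eq_zero] at h1
  obtain ⟨r, hr⟩ := he.exists_eq_smul_cofactorField hpe hη0 hne hZ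
  have hψη : ψ p (cofactorField μ φ e n p) ≠ 0 := fun H => hne (h.front p _ hη0 H)
  have hr0 : r ≠ 0 := by
    rintro rfl
    exact hZ0 (by simpa using hr)
  rw [hnp, hr, map_smul, real_inner_smul_left]
  exact mul_ne_zero hr0 (inner_self_ne_zero.2 hψη)

/-! ### Boundedness of the curvature when the second fundamental form is O(λ). -/

section Bound

variable {W E : Type*} [AddCommGroup W] [Module ℝ W] [NormedAddCommGroup E]
  [InnerProductSpace ℝ E]

/-- A bound for the Gram-type determinant of a pair of linear maps `T`, `S` of which `T` is
nearly degenerate in a single direction. -/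
theorem abs_gram_le_of_bounds {T S : W →ₗ[ℝ] E}
    (hsym : ∀ X Y, inner ℝ (T X) (S Y) = inner ℝ (T Y) (S X)) {N : W → ℝ} (hN : ∀ X, 0 ≤ N X)
    {ℓ : W →ₗ[ℝ] ℝ} {l A B R c : ℝ} (hl : 0 ≤ l) (hA : 0 ≤ A) (hB : 0 ≤ B) (hR : 0 ≤ R)
    (h₁ : ∀ X Y, |inner ℝ (T X) (S Y)| ≤ A * l * N X * N Y) (h₂ : ∀ Y, ‖S Y‖ ≤ B * N Y)
    (h₃ : ∀ Y, l * N Y ≤ R * ‖T Y‖) (h₄ : ∀ X, ℓ X = 0 → N X ≤ c * ‖T X‖) (X Y : W) :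
    |inner ℝ (T X) (S X) * inner ℝ (T Y) (S Y) - inner ℝ (T Y) (S X) ^ 2| ≤
      (A * B * R + A ^ 2 * R ^ 2) * c ^ 2 *
        (inner ℝ (T X) (T X) * inner ℝ (T Y) (T Y) - inner ℝ (T X) (T Y) ^ 2) := by
  have horth : ∀ X Y, ℓ X = 0 → inner ℝ (T X) (T Y) = 0 →
      |inner ℝ (T X) (S X) * inner ℝ (T Y) (S Y) - inner ℝ (T Y) (S X) ^ 2| ≤
        (A * B * R + A ^ 2 * R ^ 2) * c ^ 2 *
          (inner ℝ (T X) (T X) * inner ℝ (T Y) (T Y) - inner ℝ (T X) (T Y) ^ 2) := by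
    intro X Y hX hXY
    have hNX := hN X
    have hNY := hN Y
    have hYY : |inner ℝ (T Y) (S Y)| ≤ ‖T Y‖ * (B * N Y) :=
      (abs_real_inner_le_norm _ _).trans (by gcongr; exact h₂ Y)
    have e1 : |inner ℝ (T X) (S X)| * |inner ℝ (T Y) (S Y)| ≤
        A * B * R * (N X ^ 2 * ‖T Y‖ ^ 2) := by
      calc _ ≤ (A * l * N X * N X) * (‖T Y‖ * (B * N Y)) := by
            gcongr
            exact h₁ X X
        _ = A * B * N X ^ 2 * ‖T Y‖ * (l * N Y) := by ring
        _ ≤ A * B * N X ^ 2 * ‖T Y‖ * (R * ‖T Y‖) := by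
            exact mul_le_mul_of_nonneg_left (h₃ Y) (by positivity)
        _ = _ := by ring
    have e2 : |inner ℝ (T Y) (S X)| ^ 2 ≤ A ^ 2 * R ^ 2 * (N X ^ 2 * ‖T Y‖ ^ 2) := by
      have : |inner ℝ (T Y) (S X)| ≤ A * N X * (R * ‖T Y‖) := by
        calc _ ≤ A * l * N Y * N X := h₁ Y X
          _ = A * N X * (l * N Y) := by ring
          _ ≤ _ := mul_le_mul_of_nonneg_left (h₃ Y) (by positivity)
      calc _ ≤ (A * N X * (R * ‖T Y‖)) ^ 2 := by gcongr
        _ = _ := by ring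
    have e3 : N X ^ 2 ≤ c ^ 2 * ‖T X‖ ^ 2 := by
      rw [← mul_pow]
      gcongr
      exact h₄ X hX
    calc _ ≤ |inner ℝ (T X) (S X) * inner ℝ (T Y) (S Y)| + |inner ℝ (T Y) (S X) ^ 2| :=
          abs_sub _ _
      _ = |inner ℝ (T X) (S X)| * |inner ℝ (T Y) (S Y)| + |inner ℝ (T Y) (S X)| ^ 2 := by
          rw [abs_mul, abs_pow]
      _ ≤ (A * B * R + A ^ 2 * R ^ 2) * (N X ^ 2 * ‖T Y‖ ^ 2) := by linarith
      _ ≤ (A * B * R + A ^ 2 * R ^ 2) * ((c ^ 2 * ‖T X‖ ^ 2) * ‖T Y‖ ^ 2) := by gcongr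
      _ = _ := by
          rw [hXY, real_inner_self_eq_norm_sq, real_inner_self_eq_norm_sq]
          ring
  -- Both determinants are unchanged when a multiple of one vector is added to the other, so `Y` may
  -- be made orthogonal to `X`. The same invariance, below, moves one vector of any pair into the
  -- kernel of `ℓ`.
  have hker : ∀ X Y, ℓ X = 0 →
      |inner ℝ (T X) (S X) * inner ℝ (T Y) (S Y) - inner ℝ (T Y) (S X) ^ 2| ≤
        (A * B * R + A ^ 2 * R ^ 2) * c ^ 2 *
          (inner ℝ (T X) (T X) * inner ℝ (T Y) (T Y) - inner ℝ (T X) (T Y) ^ 2) := by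
    intro X Y hX
    set s : ℝ := inner ℝ (T X) (T Y) / inner ℝ (T X) (T X) with hs
    have h0 : inner ℝ (T X) (T (Y - s • X)) = 0 := by
      rw [map_sub, map_smul, inner_sub_right, real_inner_smul_right]
      by_cases hTX : T X = 0
      · simp [hTX]
      · rw [hs, div_mul_cancel₀ _ (inner_self_ne_zero.2 hTX), sub_self]
    have := horth X (Y - s • X) hX h0
    have e1 : inner ℝ (T X) (S X) * inner ℝ (T (Y - s • X)) (S (Y - s • X))
        - inner ℝ (T (Y - s • X)) (S X) ^ 2
        = inner ℝ (T X) (S X) * inner ℝ (T Y) (S Y) - inner ℝ (T Y) (S X) ^ 2 := by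
      simp only [map_sub, map_smul, inner_sub_left, inner_sub_right, real_inner_smul_left,
        real_inner_smul_right, hsym X Y]
      ring
    have e2 : inner ℝ (T X) (T X) * inner ℝ (T (Y - s • X)) (T (Y - s • X))
        - inner ℝ (T X) (T (Y - s • X)) ^ 2
        = inner ℝ (T X) (T X) * inner ℝ (T Y) (T Y) - inner ℝ (T X) (T Y) ^ 2 := by
      simp only [map_sub, map_smul, inner_sub_left, inner_sub_right, real_inner_smul_left,
        real_inner_smul_right, real_inner_comm (T X) (T Y)]
      ring
    rwa [e1, e2] at this
  by_cases hX : ℓ X = 0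
  · exact hker X Y hX
  · set s : ℝ := ℓ Y / ℓ X with hs
    have h0 : ℓ (Y - s • X) = 0 := by
      rw [map_sub, map_smul, hs, smul_eq_mul, div_mul_cancel₀ _ hX, sub_self]
    have := hker (Y - s • X) X h0
    have e1 : inner ℝ (T (Y - s • X)) (S (Y - s • X)) * inner ℝ (T X) (S X)
        - inner ℝ (T X) (S (Y - s • X)) ^ 2
        = inner ℝ (T X) (S X) * inner ℝ (T Y) (S Y) - inner ℝ (T Y) (S X) ^ 2 := by
      simp only [map_sub, map_smul, inner_sub_left, inner_sub_right, real_inner_smul_left,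
        real_inner_smul_right, hsym X Y]
      ring
    have e2 : inner ℝ (T (Y - s • X)) (T (Y - s • X)) * inner ℝ (T X) (T X)
        - inner ℝ (T (Y - s • X)) (T X) ^ 2
        = inner ℝ (T X) (T X) * inner ℝ (T Y) (T Y) - inner ℝ (T X) (T Y) ^ 2 := by
      simp only [map_sub, map_smul, inner_sub_left, inner_sub_right, real_inner_smul_left,
        real_inner_smul_right, real_inner_comm (T X) (T Y)]
      ring
    rwa [e1, e2] at this

end Bound

theorem eventually_norm_le {s : ∀ x : M, V x} (hs : SmoothSectionAt k F s p) :
    ∀ᶠ q in 𝓝 p, ‖s q‖ ≤ ‖s p‖ + 1 := by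
  have h : ContinuousAt (fun q => ‖s q‖) p := by
    have h1 := (smoothFunAt_inner hs hs).continuousAt.sqrt
    refine h1.congr (.of_forall fun q => ?_)
    simp only [real_inner_self_eq_norm_sq, Real.sqrt_sq (norm_nonneg _)]
  exact h.eventually_le_const (by linarith)

theorem exists_eventually_norm_le {ι : Type*} [Finite ι] {s : ι → ∀ x : M, V x}
    (hs : ∀ i, SmoothSectionAt k F (s i) p) :
    ∃ R : ℝ, 0 ≤ R ∧ ∀ᶠ q in 𝓝 p, ∀ i, ‖s i q‖ ≤ R := by
  have := Fintype.ofFinite ι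
  refine ⟨∑ i, (‖s i p‖ + 1), by positivity, ?_⟩
  rw [eventually_all]
  intro i
  filter_upwards [eventually_norm_le (hs i)] with q hq
  refine hq.trans ?_
  exact Finset.single_le_sum (f := fun i => ‖s i p‖ + 1) (fun i _ => by positivity)
    (Finset.mem_univ i)

theorem norm_sum_smul_le {E : Type*} [NormedAddCommGroup E] [InnerProductSpace ℝ E] {m : ℕ}
    (a : Fin m → ℝ) (v : Fin m → E) {R : ℝ} (hR : ∀ i, ‖v i‖ ≤ R) :
    ‖∑ i, a i • v i‖ ≤ m * R * ‖a‖ := by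
  calc ‖∑ i, a i • v i‖ ≤ ∑ i, ‖a i • v i‖ := norm_sum_le _ _
    _ ≤ ∑ _i : Fin m, ‖a‖ * R := by
        gcongr with i
        rw [norm_smul]
        gcongr
        · exact norm_le_pi_norm a i
        · exact hR i
    _ = _ := by simp; ring

theorem abs_inner_sum_smul_le {E : Type*} [NormedAddCommGroup E] [InnerProductSpace ℝ E] {m : ℕ}
    (a b : Fin m → ℝ) (v w : Fin m → E) {A : ℝ} (hA : ∀ i j, |inner ℝ (v i) (w j)| ≤ A) :
    |inner ℝ (∑ i, a i • v i) (∑ j, b j • w j)| ≤ m ^ 2 * A * ‖a‖ * ‖b‖ := by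
  rw [sum_inner]
  simp only [inner_sum, real_inner_smul_left, real_inner_smul_right]
  calc _ ≤ ∑ i, |∑ j, b j * (a i * inner ℝ (v i) (w j))| := Finset.abs_sum_le_sum_abs _ _
    _ ≤ ∑ i, ∑ j, |b j * (a i * inner ℝ (v i) (w j))| := by
        gcongr
        exact Finset.abs_sum_le_sum_abs _ _
    _ ≤ ∑ _i : Fin m, ∑ _j : Fin m, ‖b‖ * (‖a‖ * A) := by
        gcongr with i _ j _
        rw [abs_mul, abs_mul]
        have hA0 : 0 ≤ A := (abs_nonneg _).trans (hA i j)
        gcongr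
        · exact norm_le_pi_norm b j
        · exact norm_le_pi_norm a i
        · exact hA i j
    _ = _ := by simp; ring

/-- Instance of `abs_gram_le_of_bounds` with `N` the sup norm of the coordinates, `l` = |λ| and `ℓ`
the `i`-th coordinate, where the `i`-th cofactor is nonzero at `p`. On the kernel of `ℓ` the map `φ`
is injective with a bound uniform near `p`. -/
theorem IsFrontBundle.exists_bound_of_eventually_zero (h : IsFrontBundle D φ ψ)
    (hμ : IsCoorientation F μ) (he : IsPositiveChart o e) (hpe : p ∈ e.source)
    (hp : p ∈ singularSet φ) (hdl : dJacobian μ φ e p ≠ 0) {n : ∀ x : M, V x}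
    (hn : SmoothSectionAt k F n p) (hne : cofactorField μ φ e n p ≠ 0)
    (hII : ∀ X Y : ∀ x : M, TangentSpace (𝓡 (k + 1)) x, SmoothFieldAt X p → SmoothFieldAt Y p →
      ∀ᶠ q in 𝓝 p, jacobian μ φ e q = 0 → inner ℝ (φ q (X q)) (ψ q (Y q)) = 0) :
    ∃ C : ℝ, ∀ᶠ q in 𝓝 p, q ∉ singularSet φ →
      ∀ X Y, |extNum φ ψ q X Y| ≤ C * extDen φ q X Y := by
  have hfield := fun j => he.smoothFieldAt_coordVec hpe j
  have hφ := fun j => h.coherent_fst.smoothSectionAt_apply (hfield j)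
  have hψ := fun j => h.coherent_snd.smoothSectionAt_apply (hfield j)
  have hlam : SmoothFunAt k (jacobian μ φ e) p := smoothFunAt_jacobian h.coherent_fst hμ he hpe
  obtain ⟨i, hi⟩ : ∃ i, cofactor μ φ e n i p ≠ 0 := by
    by_contra! H
    exact hne (by simp [cofactorField, H])
  have hcof : ContinuousAt (cofactor μ φ e n i) p :=
    (smoothFunAt_cofactor h.coherent_fst hμ he hpe hn i).continuousAt
  have hO : ∀ j l, ∃ A : ℝ, 0 ≤ A ∧ ∀ᶠ q in 𝓝 p,
      |inner ℝ (φ q (coordVec e j q)) (ψ q (coordVec e l q))| ≤ A * |jacobian μ φ e q| := by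
    intro j l
    have hO := ContMDiffAt.isBigO_of_eventually_zero
      (h.smoothFunAt_inner_apply (hfield j) (hfield l)) hlam (by simp) hdl
      ((he.mem_singularSet_iff h.coherent_fst.rank_eq hμ hpe).1 hp)
      (hII _ _ (hfield j) (hfield l))
    obtain ⟨A, hA, hb⟩ := hO.exists_nonneg
    exact ⟨A, hA, hb.bound⟩
  choose A hA0 hA using hO
  set A' : ℝ := ∑ j, ∑ l, A j l with hA'
  have hAle : ∀ j l, A j l ≤ A' := fun j l =>
    (Finset.single_le_sum (f := fun l => A j l) (fun l _ => hA0 j l) (Finset.mem_univ l)).trans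
      (Finset.single_le_sum (f := fun j => ∑ l, A j l)
        (fun j _ => Finset.sum_nonneg fun l _ => hA0 j l) (Finset.mem_univ j))
  have hA'0 : 0 ≤ A' := Finset.sum_nonneg fun j _ => Finset.sum_nonneg fun l _ => hA0 j l
  obtain ⟨R₁, hR₁0, hR₁⟩ := exists_eventually_norm_le hφ
  obtain ⟨R₂, hR₂0, hR₂⟩ := exists_eventually_norm_le hψ
  -- One bound for the `φ(∂_j)` and for `n`, which replaces one of them in the estimate on the
  -- hyperplane.
  set R : ℝ := R₁ + (‖n p‖ + 1) with hR
  have hR0 : 0 ≤ R := by positivity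
  -- Half the value at `p`, so that the cofactor stays above it in a neighborhood.
  set c : ℝ := |cofactor μ φ e n i p| / 2 with hc
  have hc0 : 0 < c := by positivity
  refine ⟨((k + 1 : ℕ) ^ 2 * A' * ((k + 1 : ℕ) * R₂) * R ^ k +
    ((k + 1 : ℕ) ^ 2 * A') ^ 2 * (R ^ k) ^ 2) * (R ^ k / c) ^ 2, ?_⟩
  filter_upwards [eventually_all.2 fun j => eventually_all.2 (hA j), hR₁, hR₂,
    eventually_norm_le hn, e.open_source.mem_nhds hpe,
    hcof.abs.eventually_const_le (show c < |cofactor μ φ e n i p| by rw [hc]; linarith [abs_pos.2 hi])]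
    with q hAq hR₁q hR₂q hnq hqe hcq hqs X Y
  obtain ⟨b, hb, -⟩ := he.exists_basis hqe
  have hV := finrank_fiber (V := V) h.coherent_fst.rank_eq q
  have hφsum : ∀ Z, φ q Z = ∑ j, b.repr Z j • φ q (coordVec e j q) := fun Z => by
    conv_lhs => rw [← b.sum_repr Z]
    simp [hb]
  have hψsum : ∀ Z, ψ q Z = ∑ j, b.repr Z j • ψ q (coordVec e j q) := fun Z => by
    conv_lhs => rw [← b.sum_repr Z]
    simp [hb]
  have hR₁' : ∀ j, ‖φ q (coordVec e j q)‖ ≤ R := fun j =>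
    (hR₁q j).trans (by rw [hR]; linarith [norm_nonneg (n p)])
  have hnq' : ‖n q‖ ≤ R := hnq.trans (by rw [hR]; linarith)
  rw [h.extNum_eq]
  refine abs_gram_le_of_bounds (T := (φ q).toLinearMap) (S := (ψ q).toLinearMap)
    (h.compatible q) (N := fun Z => ‖(b.repr Z : Fin (k + 1) → ℝ)‖) (fun _ => norm_nonneg _)
    (ℓ := b.coord i) (l := |jacobian μ φ e q|) (abs_nonneg _) (by positivity) (by positivity)
    (by positivity) ?_ ?_ ?_ ?_ X Y
  · intro X Y
    simp only [ContinuousLinearMap.coe_coe]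
    rw [hφsum X, hψsum Y]
    refine (abs_inner_sum_smul_le _ _ _ _ (A := A' * |jacobian μ φ e q|)
      fun j l => (hAq j l).trans ?_).trans (le_of_eq ?_)
    · gcongr
      exact hAle j l
    · ring
  · intro Y
    simp only [ContinuousLinearMap.coe_coe]
    rw [hψsum Y]
    exact norm_sum_smul_le _ _ hR₂q
  · intro Y
    simp only [ContinuousLinearMap.coe_coe]
    have h1 : ∀ j, |b.repr Y j| * |jacobian μ φ e q| ≤ R ^ k * ‖φ q Y‖ := fun j => by
      rw [hφsum Y]
      exact (μ q).abs_coeff_mul_abs_le hV (hμ.unit q) _ hR₁' _ j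
    by_cases hj : |jacobian μ φ e q| = 0
    · rw [hj, zero_mul]
      positivity
    have hjpos : 0 < |jacobian μ φ e q| := lt_of_le_of_ne (abs_nonneg _) (Ne.symm hj)
    rw [mul_comm, ← le_div_iff₀ hjpos, pi_norm_le_iff_of_nonneg (by positivity)]
    intro j
    rw [le_div_iff₀ hjpos]
    exact h1 j
  · intro X hX
    simp only [ContinuousLinearMap.coe_coe]
    have hXi : b.repr X i = 0 := hX
    set v := Function.update (fun j => φ q (coordVec e j q)) i (n q) with hv
    have hsum : φ q X = ∑ j, b.repr X j • v j := by
      rw [hφsum X]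
      refine Finset.sum_congr rfl fun j _ => ?_
      by_cases hj : j = i
      · rw [hj, hXi, zero_smul, zero_smul]
      · rw [hv, Function.update_of_ne hj]
    have hvR : ∀ j, ‖v j‖ ≤ R := fun j => by
      by_cases hj : j = i
      · rw [hv, hj, Function.update_self]
        exact hnq'
      · rw [hv, Function.update_of_ne hj]
        exact hR₁' j
    have h1 : ∀ j, |b.repr X j| * |cofactor μ φ e n i q| ≤ R ^ k * ‖φ q X‖ := fun j => by
      rw [hsum]
      exact (μ q).abs_coeff_mul_abs_le hV (hμ.unit q) _ hvR _ j
    rw [pi_norm_le_iff_of_nonneg (by positivity)]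
    intro j
    rw [div_mul_eq_mul_div, le_div_iff₀ hc0]
    refine le_trans ?_ (h1 j)
    rw [Real.norm_eq_abs]
    gcongr

/-! ### First-order expansion at a singular point, transversally to the singular set. -/

namespace IsFrontBundle

variable {lam : M → ℝ} {n : ∀ x : M, V x} {η : ∀ x : M, TangentSpace (𝓡 (k + 1)) x}

/-- If the image of `φ_p` is the orthogonal complement of the unit vector `n_p`, then `ψ` maps
null vectors to multiples of `n_p`. -/
theorem map_null_eq_smul (h : IsFrontBundle D φ ψ) {v : V p} (hv : inner ℝ v v = (1 : ℝ))
    (himg : ∀ z, inner ℝ (φ p z) v = (0 : ℝ)) (hperp : ∀ u, inner ℝ u v = (0 : ℝ) → ∃ z, φ p z = u)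
    {Z : TangentSpace (𝓡 (k + 1)) p} (hZ : φ p Z = 0) : ψ p Z = inner ℝ v (ψ p Z) • v := by
  rw [← sub_eq_zero]
  set w := ψ p Z - inner ℝ v (ψ p Z) • v with hw
  have hwv : inner ℝ w v = 0 := by
    rw [hw, inner_sub_left, real_inner_smul_left, hv, real_inner_comm]
    ring
  obtain ⟨z, hz⟩ := hperp w hwv
  rw [← inner_self_eq_zero (𝕜 := ℝ)]
  calc inner ℝ w w = inner ℝ (φ p z) (ψ p Z - inner ℝ v (ψ p Z) • v) := by rw [hz]
    _ = 0 := by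
      rw [inner_sub_right, real_inner_smul_right, himg, h.compatible, hZ, inner_zero_left]
      ring

/-- The derivative of the second fundamental form in the null direction, expressed by the
covariant derivative of the conormal field. -/
theorem mvfderiv_inner_null (h : IsFrontBundle D φ ψ) (hd : IsNullDivision F φ p lam n η)
    (hp : p ∈ singularSet φ) (hdl : mvfderiv (𝓡 (k + 1)) lam p ≠ 0)
    (hII : ∀ X Y, inner ℝ (φ p X) (ψ p Y) = 0) (hn1 : inner ℝ (n p) (n p) = (1 : ℝ))
    (hperp : ∀ u, inner ℝ u (n p) = (0 : ℝ) → ∃ z, φ p z = u)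
    (hnorm : ∀ᶠ q in 𝓝 p, lam q = 0 → ∀ z, inner ℝ (φ q z) (n q) = (0 : ℝ))
    {X : ∀ x : M, TangentSpace (𝓡 (k + 1)) x} (hX : SmoothFieldAt X p)
    (hXl : mvfderiv (𝓡 (k + 1)) lam p (X p) = 0) :
    mvfderiv (𝓡 (k + 1)) (fun x => inner ℝ (φ x (X x)) (ψ x (X x))) p (η p) =
      inner ℝ (n p) (ψ p (η p)) * inner ℝ (φ p (X p)) (D n p (X p)) := by
  have hl0 := hd.lam_eq_zero hp
  have hφX := h.coherent_fst.smoothSectionAt_apply hX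
  have hψX := h.coherent_snd.smoothSectionAt_apply hX
  have hψη := h.coherent_snd.smoothSectionAt_apply hd.smooth_field
  obtain ⟨z, hz⟩ := h.coherent_fst.exists_connection_swap hX hd.smooth_field
  obtain ⟨z', hz'⟩ := h.coherent_snd.exists_connection_swap hX hd.smooth_field
  rw [hd.connection_map_field h.coherent_fst hp, hXl, zero_smul, zero_add] at hz
  rw [h.coherent_fst.mvfderiv_inner hφX hψX, hz, hz', hII, zero_add, inner_add_right, hII,
    add_zero]
  -- What remains is ⟨φX, D_X ψη⟩. The functions ⟨φX, ψη⟩ and ⟨φX, n⟩ vanish on the singular set, so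
  -- their derivatives along the tangent vector X are zero. Since ψη = ρn at `p`, subtracting ρ
  -- times the second identity from the first removes ⟨D_X φX, n⟩.
  have hg : mvfderiv (𝓡 (k + 1)) (fun x => inner ℝ (φ x (X x)) (ψ x (η x))) p (X p) = 0 := by
    refine mvfderiv_eq_zero_of_isBigO (smoothFunAt_inner hφX hψη).mdifferentiableAt
      hd.smooth_lam.mdifferentiableAt hl0 ?_ hXl
    refine ContMDiffAt.isBigO_of_eventually_zero (smoothFunAt_inner hφX hψη) hd.smooth_lam
      (by simp) hdl hl0 ?_
    filter_upwards [hd.map_field] with q hm hq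
    rw [h.compatible, hm, hq, zero_smul, inner_zero_left]
  have hu : mvfderiv (𝓡 (k + 1)) (fun x => inner ℝ (φ x (X x)) (n x)) p (X p) = 0 := by
    refine mvfderiv_eq_zero_of_isBigO (smoothFunAt_inner hφX hd.smooth_section).mdifferentiableAt
      hd.smooth_lam.mdifferentiableAt hl0 ?_ hXl
    refine ContMDiffAt.isBigO_of_eventually_zero (smoothFunAt_inner hφX hd.smooth_section)
      hd.smooth_lam (by simp) hdl hl0 ?_
    filter_upwards [hnorm] with q hq hlq
    exact hq hlq _
  rw [h.coherent_fst.mvfderiv_inner hφX hψη, h.map_null_eq_smul hn1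
    (hnorm.self_of_nhds hl0) hperp (hd.map_field_eq_zero hp), real_inner_smul_right] at hg
  rw [h.coherent_fst.mvfderiv_inner hφX hd.smooth_section] at hu
  linear_combination hg - inner ℝ (n p) (ψ p (η p)) * hu

variable {ζ : ∀ x : M, TangentSpace (𝓡 (k + 1)) x}

/-- The derivative along the null field of the pairing of `φ(ζ)` with a section orthogonal to the
image of `φ`, for a field `ζ` which is null along the singular set. -/
theorem mvfderiv_inner_map_field (h : IsCoherentTangentBundle D φ)
    (hd : IsNullDivision F φ p lam n η) (hp : p ∈ singularSet φ) (hζ : SmoothFieldAt ζ p) {r : ℝ}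
    (hr : ζ p = r • η p) {s : ∀ x : M, V x} (hs : SmoothSectionAt k F s p)
    (hsφ : ∀ z, inner ℝ (φ p z) (s p) = (0 : ℝ)) :
    mvfderiv (𝓡 (k + 1)) (fun x => inner ℝ (φ x (ζ x)) (s x)) p (η p) =
      r * mvfderiv (𝓡 (k + 1)) lam p (η p) * inner ℝ (n p) (s p) := by
  obtain ⟨z, hz⟩ := h.exists_connection_swap hζ hd.smooth_field
  rw [hd.connection_map_field h hp] at hz
  rw [h.mvfderiv_inner (h.smoothSectionAt_apply hζ) hs, hz, inner_add_left, hsφ, hr, map_smul,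
    map_smul, hd.map_field_eq_zero hp, smul_zero, inner_zero_left, real_inner_smul_left,
    smul_eq_mul]
  ring

/-- Only planes through ζ are controlled, and φ(ζ) need not be a multiple of `n`. The function ⟨φζ,
ψζ⟩ replaces λ: it vanishes at `p` with nonzero derivative along η, and a nonnegative numerator
forces its product with ⟨φX, ψX⟩ to be nonnegative. -/
theorem inner_eq_zero_of_extNum_nonneg (h : IsFrontBundle D φ ψ)
    (hd : IsNullDivision F φ p lam n η) (hp : p ∈ singularSet φ)
    (hdη : mvfderiv (𝓡 (k + 1)) lam p (η p) ≠ 0) (hρ : inner ℝ (n p) (ψ p (η p)) ≠ 0)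
    (hζ : SmoothFieldAt ζ p) {r : ℝ} (hr0 : r ≠ 0) (hr : ζ p = r • η p)
    (hnull : ∀ᶠ q in 𝓝 p, lam q = 0 → φ q (ζ q) = 0)
    (hnum : ∀ᶠ q in 𝓝 p, lam q ≠ 0 → ∀ X, 0 ≤ extNum φ ψ q X (ζ q))
    (X Y : TangentSpace (𝓡 (k + 1)) p) : inner ℝ (φ p X) (ψ p Y) = 0 := by
  refine h.inner_eq_zero_of_diag (fun X₀ => ?_) X Y
  obtain ⟨X, hX, rfl⟩ := exists_smoothFieldAt_eq X₀
  have hη0 := hd.map_field_eq_zero hp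
  have hψζ := h.coherent_snd.smoothSectionAt_apply hζ
  have hdh := mvfderiv_inner_map_field h.coherent_fst hd hp hζ hr hψζ fun z => by
    rw [h.compatible, hr, map_smul, hη0, smul_zero, inner_zero_left]
  rw [hr, map_smul, real_inner_smul_right] at hdh
  have hne : mvfderiv (𝓡 (k + 1)) (fun x => inner ℝ (φ x (ζ x)) (ψ x (ζ x))) p ≠ 0 := by
    intro H
    rw [H] at hdh
    exact mul_ne_zero (mul_ne_zero hr0 hdη) (mul_ne_zero hr0 hρ) hdh.symm
  have hzero := SmoothFunAt.eventually_eq_zero_of_mul_nonneg (h.smoothFunAt_inner_apply hζ hζ)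
    (h.smoothFunAt_inner_apply hX hX) hne (by
      filter_upwards [hnull, hnum] with q hq hnq hhq
      have hlq : lam q ≠ 0 := fun H => hhq (by rw [hq H, inner_zero_left])
      have := hnq hlq (X q)
      rw [h.extNum_eq] at this
      nlinarith [sq_nonneg (inner ℝ (φ q (ζ q)) (ψ q (X q)))])
  refine hzero.self_of_nhds ?_
  rw [hr, map_smul, hη0, smul_zero, inner_zero_left]

/-- Cauchy–Schwarz for `v` and the component of φ(Z) orthogonal to φ(X), scaled by |φX|². It bounds
the denominator below through pairings whose quotients by λ have limits. -/
theorem _root_.FrontBundles.sq_le_extDen_mul {x : M} (X Z : TangentSpace (𝓡 (k + 1)) x)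
    (v : V x) :
    (inner ℝ (φ x X) (φ x X) * inner ℝ (φ x Z) v - inner ℝ (φ x Z) (φ x X) * inner ℝ (φ x X) v) ^ 2
      ≤ extDen φ x X Z * (inner ℝ (φ x X) (φ x X) * inner ℝ v v) := by
  have h1 := norm_sq_smul_sub_inner_smul (φ x X) (φ x Z)
  have h2 := real_inner_mul_inner_self_le
    (inner ℝ (φ x X) (φ x X) • φ x Z - inner ℝ (φ x X) (φ x Z) • φ x X) v
  rw [real_inner_self_eq_norm_sq (_ - _), h1, inner_sub_left, real_inner_smul_left,
    real_inner_smul_left] at h2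
  rw [extDen, formI, formI, formI, real_inner_comm (φ x X) (φ x Z), sq]
  linarith [h2]

/-- The second order inequality at a singular point that results from a lower bound of the
extrinsic curvature of the planes containing a null direction. -/
theorem mul_inner_le_of_mul_extDen_le (h : IsFrontBundle D φ ψ)
    (hd : IsNullDivision F φ p lam n η) (hp : p ∈ singularSet φ)
    (hdη : mvfderiv (𝓡 (k + 1)) lam p (η p) ≠ 0)
    (hII : ∀ X Y, inner ℝ (φ p X) (ψ p Y) = 0) (hn1 : inner ℝ (n p) (n p) = (1 : ℝ))
    (himg : ∀ z, inner ℝ (φ p z) (n p) = (0 : ℝ))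
    (hζ : SmoothFieldAt ζ p) {r : ℝ} (hr0 : r ≠ 0) (hr : ζ p = r • η p) {δ : ℝ} (hδ : 0 ≤ δ)
    (hnum : ∀ᶠ q in 𝓝 p, lam q ≠ 0 → ∀ X, δ * extDen φ q X (ζ q) ≤ extNum φ ψ q X (ζ q))
    {X : ∀ x : M, TangentSpace (𝓡 (k + 1)) x} (hX : SmoothFieldAt X p) (hX0 : φ p (X p) ≠ 0) :
    δ * inner ℝ (φ p (X p)) (φ p (X p)) ≤
      mvfderiv (𝓡 (k + 1)) (fun x => inner ℝ (φ x (X x)) (ψ x (X x))) p (η p) /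
        mvfderiv (𝓡 (k + 1)) lam p (η p) * inner ℝ (n p) (ψ p (η p)) := by
  have hη0 := hd.map_field_eq_zero hp
  have hζ0 : φ p (ζ p) = 0 := by rw [hr, map_smul, hη0, smul_zero]
  have hφX := h.coherent_fst.smoothSectionAt_apply hX
  have hφζ := h.coherent_fst.smoothSectionAt_apply hζ
  have hψζ := h.coherent_snd.smoothSectionAt_apply hζ
  obtain ⟨l, hl, hlp, hl0, hlim⟩ := exists_filter_tendsto_div hd.smooth_lam.mdifferentiableAt
    (hd.lam_eq_zero hp) hdη
  have hf := hlim _ (h.smoothFunAt_inner_apply hX hX).mdifferentiableAt (hII _ _)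
  have hh := hlim _ (h.smoothFunAt_inner_apply hζ hζ).mdifferentiableAt (hII _ _)
  have hα := hlim _ (smoothFunAt_inner hφζ hd.smooth_section).mdifferentiableAt (himg _)
  have hβ := hlim _ (smoothFunAt_inner hφζ hφX).mdifferentiableAt
    (by rw [hζ0, inner_zero_left])
  have hγ : Tendsto (fun x => inner ℝ (φ x (X x)) (n x)) l (𝓝 0) := by
    have := (smoothFunAt_inner hφX hd.smooth_section).continuousAt.tendsto.mono_left hlp
    rwa [himg] at this
  have hu : Tendsto (fun x => inner ℝ (φ x (X x)) (φ x (X x))) l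
      (𝓝 (inner ℝ (φ p (X p)) (φ p (X p)))) :=
    (smoothFunAt_inner hφX hφX).continuousAt.tendsto.mono_left hlp
  have hnn : Tendsto (fun x => inner ℝ (n x) (n x)) l (𝓝 (1 : ℝ)) := by
    have := (smoothFunAt_inner hd.smooth_section hd.smooth_section).continuousAt.tendsto.mono_left
      hlp
    rwa [hn1] at this
  rw [mvfderiv_inner_map_field h.coherent_fst hd hp hζ hr hψζ fun z => hII _ _] at hh
  rw [mvfderiv_inner_map_field h.coherent_fst hd hp hζ hr hd.smooth_section himg] at hα
  rw [hr, map_smul, real_inner_smul_right] at hh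
  rw [hn1] at hα
  have hleft := ((((hu.mul hα).sub (hβ.mul hγ)).pow 2).const_mul δ)
  have hright := ((hu.mul hnn).mul (hf.mul hh))
  -- The curvature inequality multiplied by |φX|²|n|² and divided by λ², with the nonnegative term
  -- ⟨φζ, ψX⟩² discarded. The limits share the positive factor u r², cancelled at the end.
  have hle := le_of_tendsto_of_tendsto hleft hright (by
    filter_upwards [hl0, hnum.filter_mono hlp] with q hq0 hq
    have h1 := hq hq0 (X q)
    have h2 := mul_le_mul_of_nonneg_left (sq_le_extDen_mul (φ := φ) (X q) (ζ q) (n q)) hδ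
    have hnu : 0 ≤ inner ℝ (φ q (X q)) (φ q (X q)) * inner ℝ (n q) (n q) :=
      mul_nonneg real_inner_self_nonneg real_inner_self_nonneg
    have h3 := mul_le_mul_of_nonneg_right h1 hnu
    rw [h.extNum_eq] at h3
    have hlsq : 0 < lam q ^ 2 := by positivity
    have e1 : δ * (inner ℝ (φ q (X q)) (φ q (X q)) * (inner ℝ (φ q (ζ q)) (n q) / lam q)
        - inner ℝ (φ q (ζ q)) (φ q (X q)) / lam q * inner ℝ (φ q (X q)) (n q)) ^ 2
        = δ * (inner ℝ (φ q (X q)) (φ q (X q)) * inner ℝ (φ q (ζ q)) (n q)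
        - inner ℝ (φ q (ζ q)) (φ q (X q)) * inner ℝ (φ q (X q)) (n q)) ^ 2 / lam q ^ 2 := by
      field_simp
    have e2 : inner ℝ (φ q (X q)) (φ q (X q)) * inner ℝ (n q) (n q) *
        (inner ℝ (φ q (X q)) (ψ q (X q)) / lam q * (inner ℝ (φ q (ζ q)) (ψ q (ζ q)) / lam q))
        = inner ℝ (φ q (X q)) (φ q (X q)) * inner ℝ (n q) (n q) *
        (inner ℝ (φ q (X q)) (ψ q (X q)) * inner ℝ (φ q (ζ q)) (ψ q (ζ q))) / lam q ^ 2 := by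
      field_simp
    change _ ≤ _
    rw [e1, e2]
    refine div_le_div_of_nonneg_right ?_ hlsq.le
    nlinarith [mul_nonneg hnu (sq_nonneg (inner ℝ (φ q (ζ q)) (ψ q (X q))))])
  set u : ℝ := inner ℝ (φ p (X p)) (φ p (X p))
  have hupos : 0 < u := real_inner_self_pos.2 hX0
  set G := mvfderiv (𝓡 (k + 1)) (fun x => inner ℝ (φ x (X x)) (ψ x (X x))) p (η p)
  set d := mvfderiv (𝓡 (k + 1)) lam p (η p)
  set ρ : ℝ := inner ℝ (n p) (ψ p (η p))
  have e1 : δ * (u * (r * d * 1 / d)) ^ 2 = (u * r ^ 2) * (δ * u) := by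
    field_simp
  have e2 : u * 1 * (G / d * (r * d * (r * ρ) / d)) = (u * r ^ 2) * (G / d * ρ) := by
    field_simp
  rw [mul_zero, sub_zero, e1, e2] at hle
  exact le_of_mul_le_mul_left hle (by positivity)

end IsFrontBundle

/-! ### Adapted frames and eigenvectors of the singular shape operator. -/

namespace AdaptedFrame

theorem exists_sum_eq (A : AdaptedFrame F o μ φ p) (h : Module.finrank ℝ F = k + 1) {q : M}
    (hq : q ∈ A.dom) (u : V q) :
    ∃ z, u = φ q z + inner ℝ u (A.conormal q) • A.conormal q := by
  have hV := finrank_fiber (V := V) h q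
  have : FiniteDimensional ℝ (V q) := .of_finrank_pos (by omega)
  have hon := A.frame_orthonormal q hq
  have hspan : ⊤ ≤ Submodule.span ℝ (range
      (Fin.snoc (α := fun _ => V q) (fun i => φ q (A.vec i q)) (A.conormal q))) := by
    rw [hon.linearIndependent.span_eq_top_of_card_eq_finrank (by simp [hV])]
  let b := OrthonormalBasis.mk hon hspan
  refine ⟨∑ i, inner ℝ (φ q (A.vec i q)) u • A.vec i q, ?_⟩
  have := b.sum_repr' u
  rw [Fin.sum_univ_castSucc] at this
  simp only [b, OrthonormalBasis.coe_mk, Fin.snoc_castSucc, Fin.snoc_last] at this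
  rw [map_sum]
  simp only [map_smul]
  rw [real_inner_comm (A.conormal q) u]
  exact this.symm

theorem inner_conormal_self (A : AdaptedFrame F o μ φ p) {q : M} (hq : q ∈ A.dom) :
    inner ℝ (A.conormal q) (A.conormal q) = (1 : ℝ) := by
  have := (A.frame_orthonormal q hq).1 (Fin.last k)
  rw [Fin.snoc_last] at this
  rw [real_inner_self_eq_norm_sq, this, one_pow]

/-- Along the singular set the conormal field is orthogonal to the image of `φ`. -/
theorem inner_conormal_eq_zero (A : AdaptedFrame F o μ φ p) (h : Module.finrank ℝ F = k + 1)
    {q : M} (hq : q ∈ A.dom) (hs : q ∈ singularSet φ) (z : TangentSpace (𝓡 (k + 1)) q) :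
    inner ℝ (φ q z) (A.conormal q) = (0 : ℝ) := by
  -- If φ(z) had a conormal component, `n` would lie in the image of `φ`, making `φ` surjective and
  -- hence injective, against the existence of a null vector.
  by_contra hne
  obtain ⟨y, hy⟩ := A.exists_sum_eq h hq (φ q z)
  set a : ℝ := inner ℝ (φ q z) (A.conormal q)
  have hn : A.conormal q = φ q (a⁻¹ • (z - y)) := by
    rw [map_smul, map_sub]
    conv_rhs => rw [hy]
    rw [add_sub_cancel_left, smul_smul, inv_mul_cancel₀ hne, one_smul]
  have hsurj : Function.Surjective (φ q) := fun u => by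
    obtain ⟨x, hx⟩ := A.exists_sum_eq h hq u
    refine ⟨x + inner ℝ u (A.conormal q) • (a⁻¹ • (z - y)), ?_⟩
    rw [map_add, map_smul, ← hn, ← hx]
  obtain ⟨Z, hZ0, hZ⟩ := exists_null_of_mem_singularSet h hs
  have hV := finrank_fiber (V := V) h q
  have : FiniteDimensional ℝ (V q) := .of_finrank_pos (by omega)
  have hT : FiniteDimensional ℝ (TangentSpace (𝓡 (k + 1)) q) :=
    inferInstanceAs (FiniteDimensional ℝ (EuclideanSpace ℝ (Fin (k + 1))))
  have hT' : Module.finrank ℝ (TangentSpace (𝓡 (k + 1)) q) = k + 1 := by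
    change Module.finrank ℝ (EuclideanSpace ℝ (Fin (k + 1))) = k + 1
    simp
  have hinj : Function.Injective (φ q).toLinearMap :=
    (LinearMap.injective_iff_surjective_of_finrank_eq_finrank (hT'.trans hV.symm)).2 hsurj
  exact hZ0 (hinj (by simpa using hZ))

theorem exists_map_eq (A : AdaptedFrame F o μ φ p) (h : Module.finrank ℝ F = k + 1) (u : V p)
    (hu : inner ℝ u (A.conormal p) = (0 : ℝ)) : ∃ z, φ p z = u := by
  obtain ⟨z, hz⟩ := A.exists_sum_eq h A.mem_dom u
  exact ⟨z, by rw [hu, zero_smul, add_zero] at hz; exact hz.symm⟩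

theorem smoothSectionAt_conormal (A : AdaptedFrame F o μ φ p) :
    SmoothSectionAt k F A.conormal p :=
  A.conormal_smooth.contMDiffAt (A.dom_open.mem_nhds A.mem_dom)

theorem mem_chart_source (A : AdaptedFrame F o μ φ p) : p ∈ A.chart.source :=
  A.dom_subset A.mem_dom

/-- In every positive chart the cofactor field of the conormal is a positive multiple of the
null vector. -/
theorem exists_cofactorField_eq (A : AdaptedFrame F o μ φ p) (he : IsPositiveChart o e)
    (hpe : p ∈ e.source) :
    ∃ r : ℝ, 0 < r ∧ cofactorField μ φ e A.conormal p = r • A.null := by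
  obtain ⟨b, hb, hbo⟩ := he.exists_basis hpe
  obtain ⟨B, hB, hBo⟩ := A.null_pos
  have hlast : B (Fin.last k) = A.null := by rw [hB, Fin.snoc_last]
  have hcast : ∀ i : Fin k, B i.castSucc = A.vec i p := fun i => by rw [hB, Fin.snoc_castSucc]
  -- Both bases are positively oriented; this is where the sign of the factor comes from.
  have hdet : 0 < b.det B := (Module.Basis.orientation_eq_iff_det_pos b B).1 (hbo.trans hBo.symm)
  refine ⟨(b.det B)⁻¹, inv_pos.2 hdet, ?_⟩
  have := (μ p).cofactor_eq_smul_null (φ p).toLinearMap b B (A.conormal p)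
    (by rw [hlast]; exact A.null_mem)
    (by simp only [hcast]; exact A.frame_pos p A.mem_dom)
  rw [hlast] at this
  rw [← this, cofactorField]
  simp only [cofactor, hb]
  rfl

theorem null_ne_zero (A : AdaptedFrame F o μ φ p) : A.null ≠ 0 := by
  obtain ⟨B, hB, -⟩ := A.null_pos
  have hlast : B (Fin.last k) = A.null := by rw [hB, Fin.snoc_last]
  rw [← hlast]
  exact B.ne_zero _

theorem exists_eq_smul_null (A : AdaptedFrame F o μ φ p) {Z : TangentSpace (𝓡 (k + 1)) p}
    (hZ : φ p Z = 0) : ∃ r : ℝ, Z = r • A.null := by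
  obtain ⟨r, hr, hη⟩ := A.exists_cofactorField_eq A.chart_pos A.mem_chart_source
  obtain ⟨t, ht⟩ := A.chart_pos.exists_eq_smul_cofactorField A.mem_chart_source (μ := μ) (φ := φ)
    (n := A.conormal) (by rw [hη, map_smul, A.null_mem, smul_zero])
    (by rw [hη]; exact smul_ne_zero hr.ne' A.null_ne_zero) hZ
  exact ⟨t * r, by rw [ht, hη, smul_smul]⟩

/-- At an `A_2`-point the null direction is transversal to the singular set in the chart of every
adapted frame. -/
theorem dJacobian_null_ne_zero (A : AdaptedFrame F o μ φ p) (h : IsCoherentTangentBundle D φ)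
    (hμ : IsCoorientation F μ) (hp : IsA2Point o μ φ p) :
    dJacobian μ φ A.chart p A.null ≠ 0 := by
  obtain ⟨hps, e, hpe, he, hdl, hsup⟩ := hp
  have hnull : dJacobian μ φ e p A.null ≠ 0 := by
    intro H
    apply hdl
    ext w
    have hw : w ∈ (φ p).ker ⊔ singularTangent μ φ e p := hsup ▸ Submodule.mem_top
    obtain ⟨y, hy, z, hz, rfl⟩ := Submodule.mem_sup.1 hw
    obtain ⟨r, rfl⟩ := A.exists_eq_smul_null hy
    have hz' : dJacobian μ φ e p z = 0 := hz
    simp [H, hz']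
  have hn := A.smoothSectionAt_conormal
  have h1 := he.isNullDivision h hμ hpe hn
  have h2 := A.chart_pos.isNullDivision h hμ A.mem_chart_source hn
  obtain ⟨r₁, hr₁, hη₁⟩ := A.exists_cofactorField_eq he hpe
  obtain ⟨r₂, hr₂, hη₂⟩ := A.exists_cofactorField_eq A.chart_pos A.mem_chart_source
  -- The chart of the frame may differ from the one witnessing the `A_2` condition. Applying
  -- coherence to the two cofactor fields of the same conormal and pairing with it gives dλ₁(η₂) =
  -- dλ₂(η₁), and both fields are positive multiples of the null vector at `p`.
  obtain ⟨z, hz⟩ := h.exists_connection_swap h1.smooth_field h2.smooth_field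
  rw [h1.connection_map_field h hps, h2.connection_map_field h hps, hη₁, hη₂] at hz
  have hin := congrArg (fun u => inner ℝ u (A.conormal p)) hz
  simp only [inner_add_left, real_inner_smul_left, A.inner_conormal_self A.mem_dom,
    A.inner_conormal_eq_zero h.rank_eq A.mem_dom hps, map_smul, smul_eq_mul, mul_one,
    add_zero] at hin
  intro H
  have H' : mvfderiv (𝓡 (k + 1)) (jacobian μ φ A.chart) p A.null = 0 := H
  rw [H', mul_zero] at hin
  exact (mul_ne_zero hr₂.ne' hnull) hin

/-- An eigenvector of the singular shape operator, in terms of the connection. -/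
theorem exists_eigenvector (A : AdaptedFrame F o μ φ p) (h : IsCoherentTangentBundle D φ)
    (hnull : dJacobian μ φ A.chart p A.null ≠ 0) {c : ℝ}
    (hc : Module.End.HasEigenvalue (A.shapeOperator D) c) :
    ∃ X, φ p X ≠ 0 ∧ dJacobian μ φ A.chart p X = 0 ∧
      c • φ p X = -Real.sign (dJacobian μ φ A.chart p A.null) • D A.conormal p X := by
  obtain ⟨X, hX⟩ := hc.exists_hasEigenvector
  have hXS := hX.apply_eq_smul
  have hX0 : (X : TangentSpace (𝓡 (k + 1)) p) ≠ 0 := fun H => hX.2 (Subtype.ext H)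
  have hXl : dJacobian μ φ A.chart p X = 0 := X.2
  have hker : ∀ Z : TangentSpace (𝓡 (k + 1)) p, dJacobian μ φ A.chart p Z = 0 → φ p Z = 0 →
      Z = 0 := by
    intro Z hZl hZ
    obtain ⟨r, rfl⟩ := A.exists_eq_smul_null hZ
    rw [map_smul, smul_eq_mul] at hZl
    rw [(mul_eq_zero.1 hZl).resolve_right hnull, zero_smul]
  -- Injectivity makes `leftInverse` a genuine left inverse. As `n` has unit length, D_X n is
  -- orthogonal to `n` and so has a preimage under `φ`, which a multiple of the null vector corrects
  -- to a tangent one.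
  have hinj : LinearMap.ker ((φ p).toLinearMap.domRestrict (singularTangent μ φ A.chart p)) = ⊥ := by
    rw [LinearMap.ker_eq_bot']
    intro Z hZ
    exact Subtype.ext (hker Z Z.2 hZ)
  have hDn : inner ℝ (D A.conormal p X) (A.conormal p) = (0 : ℝ) := by
    have hn := A.smoothSectionAt_conormal
    have h1 := h.mvfderiv_inner hn hn (X : TangentSpace (𝓡 (k + 1)) p)
    have h2 : mvfderiv (𝓡 (k + 1)) (fun x => inner ℝ (A.conormal x) (A.conormal x)) p
        (X : TangentSpace (𝓡 (k + 1)) p) = 0 := by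
      have hev : (fun x => inner ℝ (A.conormal x) (A.conormal x)) =ᶠ[𝓝 p] fun _ => (1 : ℝ) := by
        filter_upwards [A.dom_open.mem_nhds A.mem_dom] with q hq
        exact A.inner_conormal_self hq
      rw [mvfderiv, hev.mfderiv_eq, mfderiv_const]
      rfl
    rw [h2, real_inner_comm (A.conormal p)] at h1
    rw [real_inner_comm]
    linarith
  obtain ⟨z, hz⟩ := A.exists_map_eq h.rank_eq _ hDn
  set t := dJacobian μ φ A.chart p z / dJacobian μ φ A.chart p A.null with ht
  have hz' : z - t • A.null ∈ singularTangent μ φ A.chart p := by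
    change dJacobian μ φ A.chart p _ = 0
    rw [map_sub, map_smul, smul_eq_mul, ht, div_mul_cancel₀ _ hnull, sub_self]
  have hmap : (φ p).toLinearMap.domRestrict (singularTangent μ φ A.chart p) ⟨_, hz'⟩
      = D A.conormal p X := by
    change φ p (z - t • A.null) = _
    rw [map_sub, map_smul, A.null_mem, smul_zero, sub_zero, hz]
  refine ⟨X, fun H => hX0 (hker _ hXl H), hXl, ?_⟩
  have hS : A.shapeOperator D X = -Real.sign (dJacobian μ φ A.chart p A.null) •
      (⟨_, hz'⟩ : singularTangent μ φ A.chart p) := by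
    rw [← LinearMap.leftInverse_apply_of_inj hinj ⟨_, hz'⟩, hmap]
    rfl
  rw [hS] at hXS
  have h3 := congrArg (fun Z : singularTangent μ φ A.chart p =>
    (φ p).toLinearMap.domRestrict (singularTangent μ φ A.chart p) Z) hXS
  simp only [map_smul, hmap] at h3
  exact h3.symm

end AdaptedFrame

/-- A lower bound of the extrinsic curvature of the planes containing a null field bounds the
singular principal curvatures from above. -/
theorem IsFrontBundle.exists_le_neg_mul_of_mul_extDen_le (h : IsFrontBundle D φ ψ)
    (hμ : IsCoorientation F μ) (hp : IsA2Point o μ φ p) {c : ℝ}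
    (hc : IsSingularPrincipalCurvature D o μ φ p c)
    {ζ : ∀ x : M, TangentSpace (𝓡 (k + 1)) x} (hζ : SmoothFieldAt ζ p)
    (hζnull : ∀ᶠ q in 𝓝 p, q ∈ singularSet φ → φ q (ζ q) = 0) (hζ0 : ζ p ≠ 0) {δ : ℝ} (hδ : 0 ≤ δ)
    (hnum : ∀ᶠ q in 𝓝 p, q ∉ singularSet φ →
      ∀ X, δ * extDen φ q X (ζ q) ≤ extNum φ ψ q X (ζ q)) :
    ∃ a : ℝ, 0 < a ∧ δ ≤ -(a * c) := by
  obtain ⟨A, hA⟩ := hc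
  have hps := hp.1
  have hrank := h.coherent_fst.rank_eq
  have hnull := A.dJacobian_null_ne_zero h.coherent_fst hμ hp
  have hd := A.chart_pos.isNullDivision h.coherent_fst hμ A.mem_chart_source
    A.smoothSectionAt_conormal
  obtain ⟨r, hr, hη⟩ := A.exists_cofactorField_eq A.chart_pos A.mem_chart_source
  obtain ⟨t, ht⟩ := A.exists_eq_smul_null (hζnull.self_of_nhds hps)
  set η := cofactorField μ φ A.chart A.conormal
  have hdη : mvfderiv (𝓡 (k + 1)) (jacobian μ φ A.chart) p (η p)
      = r * dJacobian μ φ A.chart p A.null := by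
    rw [hη, map_smul, smul_eq_mul, dJacobian]
  have hdη0 : mvfderiv (𝓡 (k + 1)) (jacobian μ φ A.chart) p (η p) ≠ 0 := by
    rw [hdη]
    exact mul_ne_zero hr.ne' hnull
  have ht0 : t ≠ 0 := fun H => hζ0 (by rw [ht, H, zero_smul])
  have hζη : ζ p = (t / r) • η p := by
    rw [hη, smul_smul, div_mul_cancel₀ _ hr.ne', ht]
  have himg := A.inner_conormal_eq_zero hrank A.mem_dom hps
  have hn1 := A.inner_conormal_self A.mem_dom
  have hperp := A.exists_map_eq hrank
  have hρ : inner ℝ (A.conormal p) (ψ p (η p)) ≠ 0 := fun H => by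
    have h1 := h.map_null_eq_smul hn1 himg hperp (hd.map_field_eq_zero hps)
    rw [H, zero_smul] at h1
    have h2 := h.front p _ (hd.map_field_eq_zero hps) h1
    rw [hη] at h2
    exact smul_ne_zero hr.ne' A.null_ne_zero h2
  have hζnull' : ∀ᶠ q in 𝓝 p, jacobian μ φ A.chart q = 0 → φ q (ζ q) = 0 := by
    filter_upwards [hζnull, hd.singular] with q h1 h2 h3 using h1 (h2.2 h3)
  have hnum' : ∀ᶠ q in 𝓝 p, jacobian μ φ A.chart q ≠ 0 →
      ∀ X, δ * extDen φ q X (ζ q) ≤ extNum φ ψ q X (ζ q) := by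
    filter_upwards [hnum, hd.singular] with q h1 h2 h3 using h1 (fun H => h3 (h2.1 H))
  have hII := h.inner_eq_zero_of_extNum_nonneg hd hps hdη0 hρ hζ (div_ne_zero ht0 hr.ne') hζη
    hζnull' (by
      filter_upwards [hnum'] with q h1 h2 X
      exact (mul_nonneg hδ (extDen_nonneg X (ζ q))).trans (h1 h2 X))
  have hnorm : ∀ᶠ q in 𝓝 p, jacobian μ φ A.chart q = 0 →
      ∀ z, inner ℝ (φ q z) (A.conormal q) = (0 : ℝ) := by
    filter_upwards [A.dom_open.mem_nhds A.mem_dom, hd.singular] with q h1 h2 h3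
    exact A.inner_conormal_eq_zero hrank h1 (h2.2 h3)
  obtain ⟨X₀, hX0, hXl, hXc⟩ := A.exists_eigenvector h.coherent_fst hnull hA
  obtain ⟨X, hX, rfl⟩ := exists_smoothFieldAt_eq X₀
  have hdl : mvfderiv (𝓡 (k + 1)) (jacobian μ φ A.chart) p ≠ 0 := fun H => hdη0 (by rw [H]; rfl)
  have hle := h.mul_inner_le_of_mul_extDen_le hd hps hdη0 hII hn1 himg hζ
    (div_ne_zero ht0 hr.ne') hζη hδ hnum' hX hX0
  rw [h.mvfderiv_inner_null hd hps hdl hII hn1 hperp hnorm hX hXl, hdη] at hle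
  have hXc' := congrArg (fun u => inner ℝ (φ p (X p)) u) hXc
  simp only [real_inner_smul_right] at hXc'
  set d := dJacobian μ φ A.chart p A.null
  set ρ : ℝ := inner ℝ (A.conormal p) (ψ p (η p))
  have hu : 0 < inner ℝ (φ p (X p)) (φ p (X p)) := real_inner_self_pos.2 hX0
  set u : ℝ := inner ℝ (φ p (X p)) (φ p (X p))
  set w : ℝ := inner ℝ (φ p (X p)) (D A.conormal p (X p))
  have hd0 : 0 < |d| := abs_pos.2 hnull
  have hw : w = -Real.sign d * (c * u) := by
    rw [hXc']
    rcases lt_or_gt_of_ne hnull with h1 | h1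
    · rw [Real.sign_of_neg h1]; ring
    · rw [Real.sign_of_pos h1]; ring
  -- One factor ρ comes from the limit inequality and one from `mvfderiv_inner_null`. The
  -- denominator is |dλ(η)|, since η is `r` times the null vector, and the sign in the shape
  -- operator turns `d` into |d|.
  refine ⟨ρ ^ 2 / (r * |d|), by positivity, ?_⟩
  refine le_of_mul_le_mul_right (hle.trans (le_of_eq ?_)) hu
  rw [hw]
  rcases lt_or_gt_of_ne hnull with h1 | h1
  · rw [Real.sign_of_neg h1, abs_of_neg h1]
    field_simp
  · rw [Real.sign_of_pos h1, abs_of_pos h1]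
    field_simp

end

end FrontBundles

/-! ### The theorem. -/

open FrontBundles in
theorem theorem3 {k : ℕ} {M : Type*} [TopologicalSpace M] [T2Space M]
    [ChartedSpace (EuclideanSpace ℝ (Fin (k + 1))) M]
    [IsManifold (𝓡 (k + 1)) ∞ M]
    {F : Type*} [NormedAddCommGroup F] [NormedSpace ℝ F] [FiniteDimensional ℝ F]
    {V : M → Type*} [TopologicalSpace (TotalSpace F V)]
    [∀ x, NormedAddCommGroup (V x)] [∀ x, InnerProductSpace ℝ (V x)]
    [FiberBundle F V] [VectorBundle ℝ F V]
    [ContMDiffVectorBundle ∞ F V (𝓡 (k + 1))]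
    [IsContMDiffRiemannianBundle (𝓡 (k + 1)) ∞ F V]
    (o : ∀ x : M, Orientation ℝ (TangentSpace (𝓡 (k + 1)) x) (Fin (k + 1)))
    (ho : IsManifoldOrientation o)
    (μ : ∀ x : M, V x [⋀^Fin (k + 1)]→ₗ[ℝ] ℝ) (hμ : IsCoorientation F μ)
    (D : CovariantDerivative (𝓡 (k + 1)) F V)
    (φ ψ : ∀ x : M, TangentSpace (𝓡 (k + 1)) x →L[ℝ] V x)
    (hfront : IsFrontBundle D φ ψ)
    (p : M) (hp : IsA2Point o μ φ p) :
    ((∃ U ∈ 𝓝 p, ∃ C : ℝ, ExtCurvOn φ ψ U (fun c => |c| ≤ C)) →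
      ∀ X Y : TangentSpace (𝓡 (k + 1)) p, formII φ ψ p X Y = 0) ∧
    (∀ U ∈ 𝓝 p, ExtCurvOn φ ψ U (fun c => 0 ≤ c) ∨ ExtCurvOn φ ψ U (fun c => c ≤ 0) →
      ∃ W ∈ 𝓝 p, W ⊆ U ∧ ∃ C : ℝ, ExtCurvOn φ ψ W (fun c => |c| ≤ C)) ∧
    ((∃ U ∈ 𝓝 p, ExtCurvOn φ ψ U (fun c => 0 ≤ c)) →
      ∀ c : ℝ, IsSingularPrincipalCurvature D o μ φ p c → c ≤ 0) ∧
    ((∃ (U : Set M) (η : ∀ x : M, TangentSpace (𝓡 (k + 1)) x) (δ : ℝ),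
        IsOpen U ∧ p ∈ U ∧ 0 < δ ∧
        ContMDiffOn (𝓡 (k + 1)) ((𝓡 (k + 1)).prod 𝓘(ℝ, EuclideanSpace ℝ (Fin (k + 1)))) ∞
          (fun x => TotalSpace.mk' (EuclideanSpace ℝ (Fin (k + 1))) x (η x)) U ∧
        (∀ q ∈ U ∩ singularSet φ, η q ≠ 0 ∧ φ q (η q) = 0) ∧
        (∀ q ∈ U \ singularSet φ, ∀ X : TangentSpace (𝓡 (k + 1)) q,
          LinearIndependent ℝ ![X, η q] → δ ≤ extCurv φ ψ q X (η q))) →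
      ∀ c : ℝ, IsSingularPrincipalCurvature D o μ φ p c → c < 0) := by
  obtain ⟨hps, e, hpe, he, hdl, -⟩ := id hp
  obtain ⟨n, hn, hρ⟩ := hfront.exists_section_inner_ne_zero hμ he hpe hps hdl
  have hd := he.isNullDivision hfront.coherent_fst hμ hpe hn
  have hne : cofactorField μ φ e n p ≠ 0 := fun H => hρ (by rw [H, map_zero, inner_zero_right])
  refine ⟨?_, ?_, ?_, ?_⟩
  · rintro ⟨U, hU, C, hC⟩
    exact hfront.formII_eq_zero_of_bounded hd hps hdl hρ hU hC
  · intro U hU hsign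
    obtain ⟨C, hC⟩ := hfront.exists_bound_of_eventually_zero hμ he hpe hps hdl hn hne
      fun X Y hX hY => hfront.eventually_inner_eq_zero_of_sign hd hdl hρ hU hsign hX hY
    refine ⟨_, inter_mem hU hC, inter_subset_left, C, ?_⟩
    rintro q ⟨hq, hqs⟩ X Y hXY
    have hpos := extDen_pos (injective_of_notMem_singularSet hqs) hXY
    change |extNum φ ψ q X Y / extDen φ q X Y| ≤ C
    rw [abs_div, abs_of_pos hpos, div_le_iff₀ hpos]
    exact hq.2 hqs X Y
  · rintro ⟨U, hU, hpos⟩ c hc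
    -- The cofactor field serves as the null field, with δ = 0.
    obtain ⟨a, ha, hac⟩ := hfront.exists_le_neg_mul_of_mul_extDen_le hμ hp hc hd.smooth_field
      (by
        filter_upwards [hd.singular, hd.map_field] with q h1 h2 h3
        rw [h2, h1.1 h3, zero_smul]) hne le_rfl
      (by
        filter_upwards [hU] with q hq hqs X
        exact mul_extDen_le_extNum (injective_of_notMem_singularSet hqs) (hpos q ⟨hq, hqs⟩ X _))
    exact le_of_not_gt fun H => by linarith [mul_pos ha H]
  · rintro ⟨U, η, δ, hU, hpU, hδ, hη, hnull, hK⟩ c hc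
    obtain ⟨a, ha, hac⟩ := hfront.exists_le_neg_mul_of_mul_extDen_le hμ hp hc
      (hη.contMDiffAt (hU.mem_nhds hpU))
      (by
        filter_upwards [hU.mem_nhds hpU] with q hq hqs using (hnull q ⟨hq, hqs⟩).2)
      (hnull p ⟨hpU, hps⟩).1 hδ.le
      (by
        filter_upwards [hU.mem_nhds hpU] with q hq hqs X
        exact mul_extDen_le_extNum (injective_of_notMem_singularSet hqs) (hK q ⟨hq, hqs⟩ X))
    exact lt_of_not_ge fun H => by linarith [mul_nonneg ha.le H]
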